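/- **Definitions.** A galactic graph is a finite simple graph $G=(P\cup B,E)$ whose vertex set is the disjoint union of a set $P$ of planets and a set $B$ of black holes. For $u,v\in P$ let $\mathrm{dist}_P(u,v)$ be the distance of $u$ and $v$ in the induced subgraph $G[P]$ ($\infty$ if there is no path). An instance of GMAPF consists of a galactic graph $G=(P\cup B,E)$ and two sets $S,T\subseteq P$ with $|S|=|T|=n$ such that no black hole is adjacent to a vertex of $S\cup T$. A configuration is a tuple $Q=(Q[1],\dots,Q[n])\in (P\cup B)^n$ of positions of $n$ agents; it is galactic independent if there are no two distinct agents $i\neq j$ with $Q[i],Q[j]\in P$ and $\mathrm{dist}_P(Q[i],Q[j])\le 1$. The instance is a YES-instance if there is a finite sequence $Q_0,\dots,Q_{\ell}$ of galactic independent configurations such that the set of positions in $Q_0$ is $S$, the set of positions in $Q_\ell$ is $T$, and, for all $1\le k\le \ell$ and all agents $i$, $Q_k[i]$ equals $Q_{k-1}[i]$ or is adjacent to it in $G$. The parameter is the number $n$ of agents. An induced grid graph is an induced subgraph of the Cartesian product of two paths (given only as an abstract graph, without coordinates). **Theorem.** GMAPF, restricted to inputs $(G,S,T)$ whose graph $G$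 is an induced grid graph, admits a kernel with $O(n^3)$ vertices. That is, there are an algorithm, a constant $C$ and a computable function $f:\mathbb N\to\mathbb N$ such that, on every GMAPF instance $x=(G,S,T)$ with $n$ agents for which $G$ is an induced grid graph, the algorithm runs in time polynomial in the size of $x$ and outputs a GMAPF instance $x'=(G',S',T')$, with $n'$ agents (where $G'$ need not be a grid graph), such that 1. $x$ is a YES-instance if and only if $x'$ is a YES-instance; 2. the size of (the encoding of) $x'$ is at most $f(n)$; 3. $n'\le n$; 4. $G'$ has at most $C\,n^3$ vertices (planets and black holes together). -/

import Mathlib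

/-! ### Random access machines with a step count -/

namespace RAM

/-- A state of a random access machine: registers and a memory, both holding natural numbers. -/
structure State where
  reg : ℕ → ℕ
  mem : ℕ → ℕ

/-- The state in which register `d` has been overwritten by `x`. -/
def State.setReg (s : State) (d x : ℕ) : State :=
  { s with reg := Function.update s.reg d x }

/-- The state in which memory cell `a` has been overwritten by `x`. -/
def State.setMem (s : State) (a x : ℕ) : State :=
  { s with mem := Function.update s.mem a x }

/-- Random access machine programs with structured control flow.  The arithmetic is addition and
(truncated) subtraction, there is no multiplication; `load` and `store` address the memory
indirectly, through a register. -/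
inductive Prog : Type
  /-- do nothing -/
  | skip : Prog
  /-- `r_d := k` -/
  | const (d k : ℕ) : Prog
  /-- `r_d := r_a` -/
  | copy (d a : ℕ) : Prog
  /-- `r_d := r_a + r_b` -/
  | add (d a b : ℕ) : Prog
  /-- `r_d := max (r_a - r_b) 0` -/
  | sub (d a b : ℕ) : Prog
  /-- `r_d := mem[r_a]` -/
  | load (d a : ℕ) : Prog
  /-- `mem[r_a] := r_b` -/
  | store (a b : ℕ) : Prog
  /-- first `p`, then `q` -/
  | seq (p q : Prog) : Prog
  /-- if `r_a ≠ 0` then `p` else `q` -/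
  | cond (a : ℕ) (p q : Prog) : Prog
  /-- while `r_a ≠ 0` do `p` -/
  | loop (a : ℕ) (p : Prog) : Prog

/-- `Runs p s s' t`: started in state `s`, the program `p` halts in state `s'` after exactly `t`
steps.  Every elementary instruction and every test of a register is one step. -/
inductive Runs : Prog → State → State → ℕ → Prop
  | skip (s : State) : Runs Prog.skip s s 1
  | const (d k : ℕ) (s : State) : Runs (Prog.const d k) s (s.setReg d k) 1
  | copy (d a : ℕ) (s : State) : Runs (Prog.copy d a) s (s.setReg d (s.reg a)) 1
  | add (d a b : ℕ) (s : State) : Runs (Prog.add d a b) s (s.setReg d (s.reg a + s.reg b)) 1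
  | sub (d a b : ℕ) (s : State) : Runs (Prog.sub d a b) s (s.setReg d (s.reg a - s.reg b)) 1
  | load (d a : ℕ) (s : State) : Runs (Prog.load d a) s (s.setReg d (s.mem (s.reg a))) 1
  | store (a b : ℕ) (s : State) : Runs (Prog.store a b) s (s.setMem (s.reg a) (s.reg b)) 1
  | seq {p q : Prog} {s s' s'' : State} {t t' : ℕ} :
      Runs p s s' t → Runs q s' s'' t' → Runs (Prog.seq p q) s s'' (t + t')
  | condTrue {a : ℕ} {p q : Prog} {s s' : State} {t : ℕ} :
      s.reg a ≠ 0 → Runs p s s' t → Runs (Prog.cond a p q) s s' (t + 1)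
  | condFalse {a : ℕ} {p q : Prog} {s s' : State} {t : ℕ} :
      s.reg a = 0 → Runs q s s' t → Runs (Prog.cond a p q) s s' (t + 1)
  | loopDone {a : ℕ} {p : Prog} {s : State} :
      s.reg a = 0 → Runs (Prog.loop a p) s s 1
  | loopStep {a : ℕ} {p : Prog} {s s' s'' : State} {t t' : ℕ} :
      s.reg a ≠ 0 → Runs p s s' t → Runs (Prog.loop a p) s' s'' t' →
        Runs (Prog.loop a p) s s'' (t + t' + 1)

/-- The initial state on input `w`: register `0` holds the length of `w`, memory cells
`0, …, |w| - 1` hold the bits of `w`, everything else is `0`. -/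
def initial (w : List Bool) : State where
  reg := fun r => if r = 0 then w.length else 0
  mem := fun i => (w.getD i false).toNat

/-- The state `s` presents the output `w`: register `0` holds the length of `w` and memory cells
`0, …, |w| - 1` hold the bits of `w`. -/
def State.Presents (s : State) (w : List Bool) : Prop :=
  s.reg 0 = w.length ∧ ∀ i < w.length, s.mem i = (w.getD i false).toNat

end RAM

/-! ### Parameterized problems and kernelizations -/

/-- A parameterized problem: instances encoded as bit strings, the parameter of every instance,
and the set of YES-instances. -/
structure ParamProblem where
  Inst : Type
  encode : Inst → List Bool
  param : Inst → ℕ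
  IsYes : Inst → Prop

namespace ParamProblem

/-- The map `K` is computed on the instances in `D` by a random access machine program in time
polynomial in the length of the encoded instance. -/
def PolyTimeOn (L : ParamProblem) (D : Set L.Inst) (K : L.Inst → L.Inst) : Prop :=
  ∃ (p : RAM.Prog) (q : Polynomial ℕ), ∀ x ∈ D, ∃ (s : RAM.State) (t : ℕ),
    t ≤ q.eval (L.encode x).length ∧
    RAM.Runs p (RAM.initial (L.encode x)) s t ∧
    s.Presents (L.encode (K x))

/-- `K` is a kernelization for the instances of `L` that lie in `D`: it is computable in polynomial
time, it preserves the answer, the size of its output is bounded by a computable function of the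
parameter, and it does not increase the parameter. -/
structure IsKernelizationOn (L : ParamProblem) (D : Set L.Inst) (K : L.Inst → L.Inst) : Prop where
  polyTime : L.PolyTimeOn D K
  isYes_iff : ∀ x ∈ D, (L.IsYes x ↔ L.IsYes (K x))
  size_le : ∃ f : ℕ → ℕ, Computable f ∧ ∀ x ∈ D, (L.encode (K x)).length ≤ f (L.param x)
  param_le : ∀ x ∈ D, L.param (K x) ≤ L.param x

end ParamProblem

/-! ### Galactic graphs and Galactic MAPF -/

/-- A galactic graph: a graph whose vertices are partitioned into black holes and planets. -/
structure GalacticGraph (V : Type) where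
  graph : SimpleGraph V
  blackHoles : Set V

namespace GalacticGraph

variable {V : Type}

/-- The planets are the vertices that are not black holes. -/
def planets (G : GalacticGraph V) : Set V := G.blackHolesᶜ

/-- The distance of two planets in the subgraph induced by the planets (`⊤` if there is no path). -/
noncomputable def planetDist (G : GalacticGraph V) (u v : G.planets) : ℕ∞ :=
  (G.graph.induce G.planets).edist u v

/-- A configuration of `n` agents is galactic distance-`r` independent if no two agents are on
planets at distance at most `r` within the planets. -/
def IsIndependent (G : GalacticGraph V) (r : ℕ) {n : ℕ} (Q : Fin n → V) : Prop :=
  ∀ i j : Fin n, i ≠ j → ∀ (hi : Q i ∈ G.planets) (hj : Q j ∈ G.planets),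
    ¬ G.planetDist ⟨Q i, hi⟩ ⟨Q j, hj⟩ ≤ r

/-- `Q 0, …, Q l` is a plan from `S` to `T` for `n` agents with radius `r`: in each step every agent
stays or moves to a neighbour, all configurations are galactic distance-`r` independent, and the
sets of initial and of final positions are `S` and `T`. -/
structure IsPlan (G : GalacticGraph V) (r : ℕ) (S T : Finset V) {n : ℕ} (l : ℕ)
    (Q : ℕ → Fin n → V) : Prop where
  start : Set.range (Q 0) = S
  target : Set.range (Q l) = T
  move : ∀ k < l, ∀ i, Q (k + 1) i = Q k i ∨ G.graph.Adj (Q k i) (Q (k + 1) i)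
  independent : ∀ k ≤ l, G.IsIndependent r (Q k)

end GalacticGraph

/-- An instance of Galactic MAPF: a galactic graph on the vertices `0, …, order - 1` and two
equinumerous sets `S`, `T` of planets such that no black hole is adjacent to a vertex of `S ∪ T`. -/
structure GMAPFInstance where
  order : ℕ
  galaxy : GalacticGraph (Fin order)
  S : Finset (Fin order)
  T : Finset (Fin order)
  card_eq : S.card = T.card
  subset_planets : ∀ v ∈ S ∪ T, v ∈ galaxy.planets
  not_adj : ∀ v ∈ S ∪ T, ∀ b ∈ galaxy.blackHoles, ¬ galaxy.graph.Adj v b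

namespace GMAPFInstance

/-- The number of agents. -/
def agents (I : GMAPFInstance) : ℕ := I.S.card

/-- There is a plan from `S` to `T` for the radius `1`. -/
def Solvable (I : GMAPFInstance) : Prop :=
  ∃ (l : ℕ) (Q : ℕ → Fin I.agents → Fin I.order), I.galaxy.IsPlan 1 I.S I.T l Q

open Classical in
/-- The encoding of an instance as a bit string: the number of vertices in unary, then for every
vertex three bits (is it a black hole, is it in `S`, is it in `T`) followed by its row of the
adjacency matrix. -/
noncomputable def encode (I : GMAPFInstance) : List Bool :=
  List.replicate I.order true ++ [false] ++
    (List.finRange I.order).flatMap fun v =>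
      [decide (v ∈ I.galaxy.blackHoles), decide (v ∈ I.S), decide (v ∈ I.T)] ++
        (List.finRange I.order).map fun u => decide (I.galaxy.graph.Adj v u)

/-- The graph of the instance is an induced grid graph, that is, (isomorphic to) an induced subgraph
of the Cartesian product of two paths. -/
def IsInducedGrid (I : GMAPFInstance) : Prop :=
  ∃ a b : ℕ, Nonempty
    (I.galaxy.graph ↪g
      (SimpleGraph.boxProd (SimpleGraph.pathGraph a) (SimpleGraph.pathGraph b)))

end GMAPFInstance

/-- Galactic MAPF, parameterized by the number of agents. -/
noncomputable def GMAPF : ParamProblem where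
  Inst := GMAPFInstance
  encode := GMAPFInstance.encode
  param := GMAPFInstance.agents
  IsYes := GMAPFInstance.Solvable

open Function

namespace Galactic

set_option linter.unusedSectionVars false

/-! Far from the terminals there is so much room that agents which wander off can be parked there,
so the far part of the graph may as well consist of black holes. Let `n` be the number of agents and
call a vertex far if its distance from `S ∪ T` exceeds `4 * n + 16`. Turning far vertices into black
holes only relaxes independence. For the converse, take a vertex `x` at distance `4 * n + 17` and
let `D` be the set of vertices reachable from `x` through vertices of level at least two. The
geodesic to `x` yields an induced path with `4 * (n + 4)` vertices in `D`. Every fourth path vertex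
is a parking slot, and the spare slots leave room for one more agent to walk in.

A plan in which `D` is black is simulated by keeping the agents that are neither in `D` nor next to
it and parking the others (`Storage.sim_step`). Three facts make this work: parked agents can be
redistributed over the slots up to a permutation, which is harmless since only the set of targets is
prescribed (`Storage.rearrange`); an agent in `D` can be brought to a slot (`Storage.store`); and an
agent approaching `D` can be brought in without a net change of the other agents outside
(`Storage.absorb`). Blackening these regions one after the other gives `solv_iff_blacken`.

After blackening, every vertex at distance more than `4 * n + 17` is a black hole with only black
neighbours. Eliminating it, that is, turning its neighbourhood into a clique, does not affect
solvability (`solv_elim_iff`), and after that the vertex can be cut off (`solv_isolate_iff`). The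
ball of radius `4 * n + 17` around at most `2 * n` terminals remains. Only the bound on its size
uses the grid: such a ball has `O(n ^ 2)` vertices per terminal (`card_ball_le`).

The kernel is computed by breadth first search, elimination and output of the remaining matrix. The
program is verified with a weakest precondition calculus in which a common bound on the iterations
of all loops yields a polynomial bound on the time (`exists_runs_of_wp`, `exists_cost_polynomial`).
-/

/-! ### Reconfiguration of tokens on a graph with black holes -/

section Basic

variable {V ι : Type}

/-- Two vertices are separated if they are neither equal nor adjacent. -/
def Sep (H : SimpleGraph V) (x y : V) : Prop := x ≠ y ∧ ¬ H.Adj x y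

theorem Sep.symm {H : SimpleGraph V} {x y : V} (h : Sep H x y) : Sep H y x :=
  ⟨h.1.symm, fun h' => h.2 h'.symm⟩

/-- Independence of a configuration: agents outside of the black holes `B` are separated. -/
def Indep (H : SimpleGraph V) (B : Set V) (Q : ι → V) : Prop :=
  ∀ i j, i ≠ j → Q i ∉ B → Q j ∉ B → Sep H (Q i) (Q j)

/-- One simultaneous move between independent configurations. -/
structure Step (H : SimpleGraph V) (B : Set V) (Q Q' : ι → V) : Prop where
  left : Indep H B Q
  right : Indep H B Q'
  move : ∀ i, Q' i = Q i ∨ H.Adj (Q i) (Q' i)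

/-- Reachability by finitely many moves. -/
def Reach (H : SimpleGraph V) (B : Set V) : (ι → V) → (ι → V) → Prop :=
  Relation.ReflTransGen (Step H B)

/-- Reachability up to a permutation of the agents. -/
def Eqv (H : SimpleGraph V) (B : Set V) (Q Q' : ι → V) : Prop :=
  ∃ σ : Equiv.Perm ι, Reach H B Q (Q' ∘ σ)

/-- Agents indexed by `ι` can move from the vertices of `S` to the vertices of `T`. -/
def Solv (ι : Type) (H : SimpleGraph V) (B S T : Set V) : Prop :=
  ∃ Q Q' : ι → V, Set.range Q = S ∧ Set.range Q' = T ∧ Indep H B Q ∧ Reach H B Q Q'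

variable {H : SimpleGraph V} {B : Set V} {Q Q' Q'' : ι → V}

theorem Step.symm (h : Step H B Q Q') : Step H B Q' Q :=
  ⟨h.right, h.left, fun i => (h.move i).elim (fun e => Or.inl e.symm) fun e => Or.inr e.symm⟩

theorem Step.relabel (h : Step H B Q Q') (σ : Equiv.Perm ι) : Step H B (Q ∘ σ) (Q' ∘ σ) :=
  ⟨fun _ _ hij => h.left _ _ (σ.injective.ne hij), fun _ _ hij => h.right _ _ (σ.injective.ne hij),
    fun i => h.move (σ i)⟩

theorem Reach.symm (h : Reach H B Q Q') : Reach H B Q' Q := by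
  induction h with
  | refl => exact .refl
  | tail _ h ih => exact .head h.symm ih

theorem Reach.relabel (h : Reach H B Q Q') (σ : Equiv.Perm ι) : Reach H B (Q ∘ σ) (Q' ∘ σ) := by
  induction h with
  | refl => exact .refl
  | tail _ h ih => exact .tail ih (h.relabel σ)

theorem Reach.eqv (h : Reach H B Q Q') : Eqv H B Q Q' := ⟨1, h⟩

theorem Eqv.refl (Q : ι → V) : Eqv H B Q Q := ⟨1, .refl⟩

theorem Eqv.trans (h : Eqv H B Q Q') (h' : Eqv H B Q' Q'') : Eqv H B Q Q'' := by
  obtain ⟨σ, h⟩ := h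
  obtain ⟨τ, h'⟩ := h'
  exact ⟨σ.trans τ, Relation.ReflTransGen.trans h (h'.relabel σ)⟩

theorem Eqv.symm (h : Eqv H B Q Q') : Eqv H B Q' Q := by
  obtain ⟨σ, h⟩ := h
  refine ⟨σ⁻¹, ?_⟩
  have := h.symm.relabel σ⁻¹
  rwa [comp_assoc, ← Equiv.Perm.coe_mul, mul_inv_cancel, Equiv.Perm.coe_one, comp_id] at this

theorem Reach.indep (h : Reach H B Q Q') (h0 : Indep H B Q) : Indep H B Q' := by
  cases h with
  | refl => exact h0
  | tail _ h => exact h.right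

end Basic

/-! ### Storing agents on a long induced path -/

section Storage

variable {V ι : Type} [Fintype ι] [DecidableEq ι]

/-- A connected vertex set `D` that contains a path `p 0, …, p (4 * K - 1)` along which the
`1`-Lipschitz function `lam` increases by one in every step. -/
structure Storage (H : SimpleGraph V) (D : Set V) (lam : V → ℕ) (p : ℕ → V) (K : ℕ) : Prop where
  lip : ∀ u v, H.Adj u v → lam u ≤ lam v + 1
  mem : ∀ j < 4 * K, p j ∈ D
  lam_p : ∀ j < 4 * K, lam (p j) = j
  adj : ∀ j, j + 1 < 4 * K → H.Adj (p j) (p (j + 1))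
  conn : ∀ d ∈ D, Relation.ReflTransGen (fun a b => H.Adj a b ∧ b ∈ D) d (p 0)

/-- The agents in `A` are placed according to `w`, the other ones according to `c`. -/
def mix (A : Finset ι) (w c : ι → V) : ι → V := fun i => if i ∈ A then w i else c i

/-- The positions of agents that are stored on every fourth vertex of a path. -/
def slots (p : ℕ → V) (f : ι → ℕ) : ι → V := fun i => p (4 * f i)

/-- The agents in `A` are in independent position. -/
def IndepOn (H : SimpleGraph V) (B : Set V) (A : Finset ι) (w : ι → V) : Prop :=
  ∀ i ∈ A, ∀ j ∈ A, i ≠ j → w i ∉ B → w j ∉ B → Sep H (w i) (w j)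

/-- `f` assigns different slots below `K` to the agents outside of `A`. -/
def Valid (K : ℕ) (A : Finset ι) (f : ι → ℕ) : Prop :=
  (∀ j ∉ A, f j < K) ∧ ∀ j ∉ A, ∀ k ∉ A, f j = f k → j = k

variable {H : SimpleGraph V} {B D : Set V} {lam : V → ℕ} {p : ℕ → V} {K : ℕ} {A : Finset ι}
  {w c : ι → V} {f g : ι → ℕ} {i : ι} {x y : V}

/-- An edge changes the level by at most one, so a gap of two excludes both equality and adjacency.
This certifies that agents are apart without any knowledge of the graph. -/
theorem sep_of_lam (hL : ∀ u v, H.Adj u v → lam u ≤ lam v + 1)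
    (h : lam x + 1 < lam y ∨ lam y + 1 < lam x) : Sep H x y := by
  refine ⟨?_, fun hxy => ?_⟩
  · rintro rfl; omega
  · have := hL _ _ hxy
    have := hL _ _ hxy.symm
    omega

/-- Only pairs within `A` profit from the black holes; all other pairs are required to be separated
outright. Nothing is assumed about the slots of `i` itself, since `i` stands on `x`. -/
theorem indep_update (hw : IndepOn H B A w)
    (hwc : ∀ j ∈ A, ∀ k ∉ A, k ≠ i → Sep H (w j) (c k)) (hwx : ∀ j ∈ A, Sep H (w j) x)
    (hcc : ∀ j ∉ A, ∀ k ∉ A, j ≠ i → k ≠ i → j ≠ k → Sep H (c j) (c k))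
    (hcx : ∀ j ∉ A, j ≠ i → Sep H (c j) x) (hi : i ∉ A) :
    Indep H B (update (mix A w c) i x) := by
  intro j k hjk hj hk
  by_cases hji : j = i
  · subst hji
    have hkj : k ≠ j := hjk.symm
    rw [update_self, update_of_ne hkj]
    by_cases hkA : k ∈ A
    · simpa [mix, hkA] using (hwx k hkA).symm
    · simpa [mix, hkA] using (hcx k hkA hkj).symm
  · by_cases hki : k = i
    · subst hki
      rw [update_self, update_of_ne hji]
      by_cases hjA : j ∈ A
      · simpa [mix, hjA] using hwx j hjA
      · simpa [mix, hjA] using hcx j hjA hji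
    · rw [update_of_ne hji] at hj ⊢
      rw [update_of_ne hki] at hk ⊢
      by_cases hjA : j ∈ A <;> by_cases hkA : k ∈ A <;> simp only [mix, hjA, hkA, if_true, if_false]
        at hj hk ⊢
      · exact hw j hjA k hkA hjk hj hk
      · exact hwc j hjA k hkA hki
      · exact (hwc k hkA j hjA hji).symm
      · exact hcc j hjA k hkA hji hki hjk

theorem indep_mix (hw : IndepOn H B A w) (hwc : ∀ j ∈ A, ∀ k ∉ A, Sep H (w j) (c k))
    (hcc : ∀ j ∉ A, ∀ k ∉ A, j ≠ k → Sep H (c j) (c k)) : Indep H B (mix A w c) := by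
  intro j k hjk hj hk
  by_cases hjA : j ∈ A <;> by_cases hkA : k ∈ A <;> simp only [mix, hjA, hkA, if_true, if_false]
    at hj hk ⊢
  · exact hw j hjA k hkA hjk hj hk
  · exact hwc j hjA k hkA
  · exact (hwc k hkA j hjA).symm
  · exact hcc j hjA k hkA hjk

theorem step_update (hw : IndepOn H B A w)
    (hwc : ∀ j ∈ A, ∀ k ∉ A, k ≠ i → Sep H (w j) (c k))
    (hcc : ∀ j ∉ A, ∀ k ∉ A, j ≠ i → k ≠ i → j ≠ k → Sep H (c j) (c k))
    (hwx : ∀ j ∈ A, Sep H (w j) x) (hcx : ∀ j ∉ A, j ≠ i → Sep H (c j) x)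
    (hwy : ∀ j ∈ A, Sep H (w j) y) (hcy : ∀ j ∉ A, j ≠ i → Sep H (c j) y)
    (hi : i ∉ A) (hxy : H.Adj x y) :
    Step H B (update (mix A w c) i x) (update (mix A w c) i y) := by
  refine ⟨indep_update hw hwc hwx hcc hcx hi, indep_update hw hwc hwy hcc hcy hi, fun j => ?_⟩
  by_cases hj : j = i
  · subst hj; simp [hxy]
  · simp [hj]

theorem Storage.sep (h : Storage H D lam p K) {a b : ℕ} (ha : a < 4 * K) (hb : b < 4 * K)
    (hab : a + 1 < b ∨ b + 1 < a) : Sep H (p a) (p b) := by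
  apply sep_of_lam h.lip
  rwa [h.lam_p a ha, h.lam_p b hb]

theorem Storage.slots_sep (h : Storage H D lam p K) {a b : ℕ} (ha : a < K) (hb : b < K)
    (hab : a ≠ b) : Sep H (p (4 * a)) (p (4 * b)) :=
  h.sep (by omega) (by omega) (by omega)

/-- A stored agent may walk along the path where no other stored agent interferes. -/
theorem Storage.walk (h : Storage H D lam p K) (hw : IndepOn H B A w)
    (hwp : ∀ j ∈ A, ∀ k < 4 * K, Sep H (w j) (p k)) (hi : i ∉ A)
    (hf : ∀ j ∉ A, j ≠ i → f j < K)
    (hinj : ∀ j ∉ A, ∀ k ∉ A, j ≠ i → k ≠ i → j ≠ k → f j ≠ f k) {k l : ℕ} (hkl : k ≤ l)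
    (hl : l < 4 * K) (hav : ∀ j ∉ A, j ≠ i → 4 * f j + 1 < k ∨ l + 1 < 4 * f j) :
    Reach H B (update (mix A w (slots p f)) i (p k)) (update (mix A w (slots p f)) i (p l)) := by
  induction l, hkl using Nat.le_induction with
  | base => exact .refl
  | succ l hkl ih =>
    refine .tail (ih (by omega) fun j hj hji => by have := hav j hj hji; omega) ?_
    refine step_update hw (fun j hj m hm hmi => hwp j hj _ (by have := hf m hm hmi; omega))
      (fun j hj m hm hji hmi hjm => h.slots_sep (hf j hj hji) (hf m hm hmi)
        (hinj j hj m hm hji hmi hjm)) (fun j hj => hwp j hj _ (by omega))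
      (fun j hj hji => h.sep (by have := hf j hj hji; omega) (by omega)
        (by have := hav j hj hji; omega))
      (fun j hj => hwp j hj _ (by omega))
      (fun j hj hji => h.sep (by have := hf j hj hji; omega) (by omega)
        (by have := hav j hj hji; omega)) hi (h.adj l (by omega))

theorem update_mix_slots (hi : i ∉ A) (s : ℕ) :
    update (mix A w (slots p f)) i (p (4 * s)) = mix A w (slots p (update f i s)) := by
  funext j
  by_cases hj : j = i
  · subst hj; simp [mix, hi, slots]
  · simp [mix, slots, hj]

theorem eq_range_of_downward_closed {s : Finset ℕ} (h : ∀ x, x + 1 ∈ s → x ∈ s) :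
    s = Finset.range s.card := by
  have hd : ∀ y ∈ s, ∀ x ≤ y, x ∈ s := by
    intro y
    induction y with
    | zero => intro h0 x hx; obtain rfl : x = 0 := by omega
              exact h0
    | succ y ih =>
      intro hy x hx
      rcases Nat.lt_or_ge y x with h' | h'
      · obtain rfl : x = y + 1 := by omega
        exact hy
      · exact ih (h y hy) x h'
  apply Finset.eq_of_subset_of_card_le
  · intro y hy
    have : Finset.range (y + 1) ⊆ s := fun x hx => hd y hy x (by simp at hx; omega)
    have := Finset.card_le_card this
    simp at this ⊢
    omega
  · simp

/-- As long as there is a free slot just below an occupied one, that agent moves down by one slot.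
The sum of the occupied slot numbers decreases, and at the end the occupied slots form an initial
segment. -/
theorem Storage.compress (h : Storage H D lam p K) (hw : IndepOn H B A w)
    (hwp : ∀ j ∈ A, ∀ k < 4 * K, Sep H (w j) (p k)) (hf : Valid K A f) :
    ∃ f', Valid K A f' ∧ Aᶜ.image f' = Finset.range Aᶜ.card ∧
      Reach H B (mix A w (slots p f)) (mix A w (slots p f')) := by
  induction hN : ∑ j ∈ Aᶜ, f j using Nat.strong_induction_on generalizing f with
  | _ N ih =>
    by_cases hd : ∀ s, s + 1 ∈ Aᶜ.image f → s ∈ Aᶜ.image f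
    · refine ⟨f, hf, ?_, .refl⟩
      rw [eq_range_of_downward_closed hd, Finset.card_image_of_injOn]
      intro j hj k hk hjk
      exact hf.2 j (by simpa using hj) k (by simpa using hk) hjk
    · push Not at hd
      obtain ⟨s, hs1, hs⟩ := hd
      obtain ⟨i, hi, his⟩ := Finset.mem_image.1 hs1
      have hiA : i ∉ A := by simpa using hi
      have hns : ∀ j ∉ A, f j ≠ s := fun j hj hjs =>
        hs (Finset.mem_image.2 ⟨j, by simpa using hj, hjs⟩)
      have hK := hf.1 i hiA
      have hsum : ∑ j ∈ Aᶜ, update f i s j < N := by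
        rw [← hN]
        refine Finset.sum_lt_sum (fun j _ => ?_) ⟨i, hi, by simp [his]⟩
        by_cases hj : j = i
        · subst hj; simp [his]
        · simp [hj]
      have hv : Valid K A (update f i s) := by
        constructor
        · intro j hj
          by_cases hji : j = i
          · subst hji; simp; omega
          · simpa [hji] using hf.1 j hj
        · intro j hj k hk hjk
          by_cases hji : j = i <;> by_cases hki : k = i
          · rw [hji, hki]
          · subst hji; simp [hki] at hjk
            exact absurd hjk.symm (hns k hk)
          · subst hki; simp [hji] at hjk
            exact absurd hjk (hns j hj)
          · simp [hji, hki] at hjk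
            exact hf.2 j hj k hk hjk
      obtain ⟨f', hf', him, hr⟩ := ih _ hsum hv rfl
      refine ⟨f', hf', him, Relation.ReflTransGen.trans ?_ hr⟩
      -- `Storage.walk` leads upwards, so it is used in reverse. Slots `s` and `s + 1` contain no
      -- other agent, hence the others are four or more away from the interval.
      have := (h.walk (f := f) (k := 4 * s) (l := 4 * (s + 1)) hw hwp hiA (fun j hj _ => hf.1 j hj)
        (fun j hj k hk _ _ hjk he => hjk (hf.2 j hj k hk he)) (by omega) (by omega)
        (fun j hj hji => by
          have h1 := hns j hj
          have h2 : f j ≠ s + 1 := fun he => hji (hf.2 j hj i hiA (he.trans his.symm))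
          omega)).symm
      rw [update_mix_slots hiA, update_mix_slots hiA, ← his, update_eq_self] at this
      exact this

/-- Both assignments compress to the same initial segment of slots, so the compressed configurations
differ only in the names of the stored agents. Agents cannot overtake each other on the path, which
is why equality up to a permutation is the right notion here. -/
theorem Storage.rearrange (h : Storage H D lam p K) (hw : IndepOn H B A w)
    (hwp : ∀ j ∈ A, ∀ k < 4 * K, Sep H (w j) (p k)) (hf : Valid K A f) (hg : Valid K A g) :
    Eqv H B (mix A w (slots p f)) (mix A w (slots p g)) := by
  obtain ⟨f', hf', hfi, hfr⟩ := h.compress hw hwp hf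
  obtain ⟨g', hg', hgi, hgr⟩ := h.compress hw hwp hg
  refine Eqv.trans hfr.eqv (Eqv.trans ?_ hgr.symm.eqv)
  have hex : ∀ j ∉ A, ∃ k ∉ A, g' k = f' j := by
    intro j hj
    have : f' j ∈ Aᶜ.image g' := by
      rw [hgi, ← hfi]; exact Finset.mem_image_of_mem _ (by simpa using hj)
    obtain ⟨k, hk, hkj⟩ := Finset.mem_image.1 this
    exact ⟨k, by simpa using hk, hkj⟩
  choose! t ht htg using hex
  -- The permutation fixes `A` and matches the remaining agents that occupy the same slot.
  have hinj : Injective fun j => if j ∈ A then j else t j := by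
    intro j k hjk
    by_cases hj : j ∈ A <;> by_cases hk : k ∈ A <;> simp only [hj, hk, if_true, if_false] at hjk
    · exact hjk
    · exact absurd (hjk ▸ hj) (ht k hk)
    · exact absurd (hjk ▸ hk) (ht j hj)
    · exact hf'.2 j hj k hk (by rw [← htg j hj, ← htg k hk, hjk])
  let σ : Equiv.Perm ι := Equiv.ofBijective _ (Finite.injective_iff_bijective.1 hinj)
  refine ⟨σ, ?_⟩
  have : mix A w (slots p g') ∘ σ = mix A w (slots p f') := by
    funext j
    by_cases hj : j ∈ A
    · simp [σ, mix, hj]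
    · simp [σ, mix, hj, ht j hj, slots, htg j hj]
  rw [this]
  exact .refl

/-- There is room for the agents outside of `A'` on slots that are far from the level `l` and from
the levels of the agents in `A`. -/
theorem exists_slots (hK : Fintype.card ι + 4 ≤ K) (A : Finset ι) (m : ι → ℕ) (l : ℕ) :
    ∃ f : ι → ℕ, Valid K A f ∧
      ∀ j ∉ A, (l + 7 < 4 * f j ∨ 4 * f j + 7 < l) ∧
        ∀ k ∈ A, m k + 1 < 4 * f j ∨ 4 * f j + 1 < m k := by
  -- The level of an agent in `A` spoils at most one slot, because `|4 * s - m| ≤ 1` forces `s = (m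
  -- + 1) / 4`. The margin of seven around `l` spoils at most four. This is where the `4` in
  -- `Fintype.card ι + 4` comes from.
  let bad : Finset ℕ := A.image (fun k => (m k + 1) / 4) ∪
    {(l + 7) / 4, (l + 7) / 4 - 1, (l + 7) / 4 - 2, (l + 7) / 4 - 3}
  have hbad : bad.card ≤ A.card + 4 :=
    (Finset.card_union_le _ _).trans (Nat.add_le_add Finset.card_image_le Finset.card_le_four)
  have hcard : Aᶜ.card ≤ (Finset.range K \ bad).card := by
    have h1 := Finset.le_card_sdiff bad (Finset.range K)
    have h2 := Finset.card_add_card_compl A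
    simp at h1
    omega
  obtain ⟨e⟩ := Function.Embedding.nonempty_of_card_le
    (α := (Aᶜ : Finset ι)) (β := (Finset.range K \ bad : Finset ℕ)) (by rwa [Fintype.card_coe, Fintype.card_coe])
  refine ⟨fun j => if hj : j ∉ A then e ⟨j, by simpa using hj⟩ else 0, ⟨?_, ?_⟩, ?_⟩
  · intro j hj
    have := (e ⟨j, by simpa using hj⟩).2
    simp only [Finset.mem_sdiff, Finset.mem_range] at this
    simpa [hj] using this.1
  · intro j hj k hk hjk
    simp only [hj, hk, not_false_eq_true, dite_true] at hjk
    exact congrArg Subtype.val (e.injective (Subtype.ext hjk))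
  · intro j hj
    have := (e ⟨j, by simpa using hj⟩).2
    simp only [Finset.mem_sdiff, Finset.mem_range, bad, Finset.mem_union, Finset.mem_image,
      Finset.mem_insert, Finset.mem_singleton, not_or, not_exists, not_and] at this
    simp only [hj, not_false_eq_true, dite_true]
    generalize ((e ⟨j, _⟩ : (Finset.range K \ bad : Finset ℕ)) : ℕ) = s at this
    refine ⟨by omega, fun k hk => ?_⟩
    have := this.2.1 k hk
    omega

/-! ### Bringing agents into storage -/

theorem IndepOn.mono {A' : Finset ι} (hw : IndepOn H B A w) (h : A' ⊆ A) : IndepOn H B A' w :=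
  fun i hi j hj => hw i (h hi) j (h hj)

/-- The agents in `A` are placed outside of `D` and not adjacent to `D`. -/
def Far (H : SimpleGraph V) (D : Set V) (A : Finset ι) (w : ι → V) : Prop :=
  ∀ j ∈ A, ∀ d ∈ D, Sep H (w j) d

/-- The agent walks down at most three vertices to the slot `k / 4`. The margin of five keeps this
slot free and all other agents away from the walk. -/
theorem Storage.store_path (h : Storage H D lam p K) (hw : IndepOn H B A w) (hF : Far H D A w)
    (hi : i ∉ A) {k : ℕ} (hk : k < 4 * K) (hf : Valid K (insert i A) f)
    (hav : ∀ j ∉ A, j ≠ i → k + 5 < 4 * f j ∨ 4 * f j + 5 < k) (hg : Valid K A g) :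
    Eqv H B (update (mix A w (slots p f)) i (p k)) (mix A w (slots p g)) := by
  have hwp : ∀ j ∈ A, ∀ k < 4 * K, Sep H (w j) (p k) := fun j hj k hk => hF j hj _ (h.mem k hk)
  have hr := (h.walk (f := f) (k := 4 * (k / 4)) (l := k) hw hwp hi
    (fun j hj hji => hf.1 j (by simp [hj, hji]))
    (fun j hj m hm hji hmi hjm he => hjm (hf.2 j (by simp [hj, hji]) m (by simp [hm, hmi]) he))
    (by omega) hk (fun j hj hji => by have := hav j hj hji; omega)).symm.eqv
  refine hr.trans ?_
  rw [update_mix_slots hi]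
  refine h.rearrange hw hwp ⟨?_, ?_⟩ hg
  · intro j hj
    by_cases hji : j = i
    · subst hji; simp; omega
    · simpa [hji] using hf.1 j (by simp [hj, hji])
  · intro j hj m hm hjm
    by_cases hji : j = i <;> by_cases hmi : m = i
    · rw [hji, hmi]
    · subst hji
      have := hav m hm hmi
      simp [hmi] at hjm; omega
    · subst hmi
      have := hav j hj hji
      simp [hji] at hjm; omega
    · simp [hji, hmi] at hjm
      exact hf.2 j (by simp [hj, hji]) m (by simp [hm, hmi]) hjm

/-- An agent in `D` can be brought into storage. -/
theorem Storage.store (h : Storage H D lam p K) (hK : Fintype.card ι + 4 ≤ K)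
    (hw : IndepOn H B A w) (hF : Far H D A w) (hi : i ∉ A) {d : V} (hd : d ∈ D)
    (hf : Valid K (insert i A) f)
    (hav : ∀ j ∉ A, j ≠ i → lam d + 6 < 4 * f j ∨ 4 * f j + 6 < lam d) (hg : Valid K A g) :
    Eqv H B (update (mix A w (slots p f)) i d) (mix A w (slots p g)) := by
  have hwp : ∀ j ∈ A, ∀ k < 4 * K, Sep H (w j) (p k) := fun j hj k hk => hF j hj _ (h.mem k hk)
  have hsl : ∀ {f : ι → ℕ}, Valid K (insert i A) f → ∀ j ∉ A, j ≠ i → f j < K :=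
    fun hf j hj hji => hf.1 j (by simp [hj, hji])
  have hcc : ∀ {f : ι → ℕ}, Valid K (insert i A) f → ∀ j ∉ A, ∀ k ∉ A, j ≠ i → k ≠ i → j ≠ k →
      Sep H (slots p f j) (slots p f k) := fun hf j hj k hk hji hki hjk =>
    h.slots_sep (hsl hf j hj hji) (hsl hf k hk hki)
      fun he => hjk (hf.2 j (by simp [hj, hji]) k (by simp [hk, hki]) he)
  have hwc : ∀ {f : ι → ℕ}, Valid K (insert i A) f → ∀ j ∈ A, ∀ k ∉ A, k ≠ i →
      Sep H (w j) (slots p f k) := fun hf j hj k hk hki =>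
    hwp j hj _ (by have := hsl hf k hk hki; omega)
  have hcx : ∀ {f : ι → ℕ} {x : V}, Valid K (insert i A) f →
      (∀ j ∉ A, j ≠ i → lam x + 1 < 4 * f j ∨ 4 * f j + 1 < lam x) →
      ∀ j ∉ A, j ≠ i → Sep H (slots p f j) x := by
    intro f x hf hav j hj hji
    apply sep_of_lam h.lip
    have h1 := hsl hf j hj hji
    have h2 := hav j hj hji
    simp only [slots]
    rw [h.lam_p _ (by omega)]
    omega
  have hK0 : 0 < 4 * K := by omega
  have key := h.conn d hd
  induction key using Relation.ReflTransGen.head_induction_on generalizing f with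
  | refl =>
    refine h.store_path hw hF hi hK0 hf (fun j hj hji => ?_) hg
    have := hav j hj hji
    rw [h.lam_p 0 hK0] at this
    omega
  | @head d d' hdd' _ ih =>
    obtain ⟨hadj, hd'⟩ := hdd'
    by_cases hP : ∃ k < 4 * K, d = p k
    · obtain ⟨k, hk, rfl⟩ := hP
      refine h.store_path hw hF hi hk hf (fun j hj hji => ?_) hg
      have := hav j hj hji
      rw [h.lam_p k hk] at this
      omega
    by_cases hN : ∃ k < 4 * K, H.Adj d (p k)
    · obtain ⟨k, hk, hdk⟩ := hN
      have h1 := h.lip _ _ hdk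
      have h2 := h.lip _ _ hdk.symm
      rw [h.lam_p k hk] at h1 h2
      have hs : Step H B (update (mix A w (slots p f)) i d)
          (update (mix A w (slots p f)) i (p k)) :=
        step_update hw (hwc hf) (hcc hf) (fun j hj => hF j hj d hd)
          (hcx hf fun j hj hji => by have := hav j hj hji; omega)
          (fun j hj => hwp j hj k hk)
          (hcx hf fun j hj hji => by
            have := hav j hj hji
            rw [h.lam_p k hk]
            omega) hi hdk
      refine (Reach.eqv (.single hs)).trans (h.store_path hw hF hi hk hf (fun j hj hji => ?_) hg)
      have := hav j hj hji
      omega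
    push Not at hP hN
    -- Since `d` is neither on the path nor adjacent to it, agent `i` can be treated as one of the
    -- fixed agents while the stored ones make room of margin seven around its level. After the step
    -- to `d'` a margin of six is left, as the induction requires.
    obtain ⟨f', hf', hav'⟩ := exists_slots hK (insert i A) (fun _ => lam d) (lam d)
    have h1 := h.lip _ _ hadj
    have h2 := h.lip _ _ hadj.symm
    have e1 : ∀ f : ι → ℕ, update (mix A w (slots p f)) i d =
        mix (insert i A) (update w i d) (slots p f) := by
      intro f
      funext j
      by_cases hj : j = i
      · subst hj; simp [mix]
      · simp [mix, hj]
    have r1 : Eqv H B (update (mix A w (slots p f)) i d) (update (mix A w (slots p f')) i d) := by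
      rw [e1, e1]
      refine h.rearrange ?_ ?_ hf hf'
      · intro j hj k hk hjk hjB hkB
        by_cases hji : j = i <;> by_cases hki : k = i
        · exact absurd (hji.trans hki.symm) hjk
        · subst hji
          simp [hki] at hk hkB ⊢
          exact (hF k hk d hd).symm
        · subst hki
          simp [hji] at hj hjB ⊢
          exact hF j hj d hd
        · simp [hji, hki] at hj hk hjB hkB ⊢
          exact hw j hj k hk hjk hjB hkB
      · intro j hj k hk
        by_cases hji : j = i
        · subst hji
          simp only [update_self]
          exact ⟨hP k hk, hN k hk⟩
        · simp [hji] at hj ⊢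
          exact hwp j hj k hk
    have av : ∀ j ∉ A, j ≠ i → lam d + 7 < 4 * f' j ∨ 4 * f' j + 7 < lam d :=
      fun j hj hji => (hav' j (by simp [hj, hji])).1
    have hs : Step H B (update (mix A w (slots p f')) i d) (update (mix A w (slots p f')) i d') :=
      step_update hw (hwc hf') (hcc hf') (fun j hj => hF j hj d hd)
        (hcx hf' fun j hj hji => by have := av j hj hji; omega)
        (fun j hj => hF j hj d' hd')
        (hcx hf' fun j hj hji => by have := av j hj hji; omega) hi hadj
    refine r1.trans ((Reach.eqv (.single hs)).trans (ih hd' hf' fun j hj hji => ?_))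
    have := av j hj hji
    omega

/-- An agent that is about to enter the neighbourhood of `D` can be brought into storage. -/
theorem Storage.absorb (h : Storage H D lam p K) (hK : Fintype.card ι + 4 ≤ K) {Q Q' : ι → V}
    (hQ : IndepOn H B A Q) (hQ' : IndepOn H B A Q') (hF : Far H D A Q)
    (hmv : ∀ j ∈ A, Q' j = Q j ∨ H.Adj (Q j) (Q' j)) (hi : i ∈ A) {d : V} (hd : d ∈ D)
    (hid : H.Adj (Q' i) d) (hg : Valid K ∅ g) :
    Eqv H B (mix A Q (slots p g)) (mix (A.erase i) Q (slots p g)) := by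
  -- The vertices `Q' k` may be adjacent to `D`, so the stored agents have to avoid their levels,
  -- not only the level of `d`.
  obtain ⟨f, hf, hav⟩ := exists_slots hK A (fun k => lam (Q' k)) (lam d)
  have hgv : ∀ A : Finset ι, Valid K A g := fun A =>
    ⟨fun j _ => hg.1 j (by simp), fun j _ k _ => hg.2 j (by simp) k (by simp)⟩
  have hFe : Far H D (A.erase i) Q := fun j hj => hF j (Finset.mem_of_mem_erase hj)
  have hlam : ∀ j ∉ A, lam (p (4 * f j)) = 4 * f j := fun j hj =>
    h.lam_p _ (by have := hf.1 j hj; omega)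
  have hcc : ∀ j ∉ A, ∀ k ∉ A, j ≠ k → Sep H (slots p f j) (slots p f k) := fun j hj k hk hjk =>
    h.slots_sep (hf.1 j hj) (hf.1 k hk) fun he => hjk (hf.2 j hj k hk he)
  have hwc : ∀ j ∈ A, ∀ k ∉ A, Sep H (Q j) (slots p f k) := fun j hj k hk =>
    hF j hj _ (h.mem _ (by have := hf.1 k hk; omega))
  have hI : Indep H B (mix A Q (slots p f)) := indep_mix hQ hwc hcc
  have hI' : Indep H B (mix A Q' (slots p f)) := by
    refine indep_mix hQ' (fun j hj k hk => sep_of_lam h.lip ?_) hcc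
    have := (hav k hk).2 j hj
    simp only [slots]
    rw [hlam k hk]
    exact this
  have hne : ∀ j, j ∉ A.erase i → j ≠ i → j ∉ A := fun j hj hji hjA =>
    hj (Finset.mem_erase.2 ⟨hji, hjA⟩)
  have hI'' : Indep H B (update (mix (A.erase i) Q (slots p f)) i d) := by
    refine indep_update (hQ.mono (Finset.erase_subset _ _)) (fun j hj k hk hki => ?_)
      (fun j hj => hFe j hj d hd) (fun j hj k hk hji hki hjk => ?_) (fun j hj hji => ?_) (by simp)
    · exact hwc j (Finset.mem_of_mem_erase hj) k (hne k hk hki)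
    · exact hcc j (hne j hj hji) k (hne k hk hki) hjk
    · apply sep_of_lam h.lip
      have := (hav j (hne j hj hji)).1
      simp only [slots]
      rw [hlam j (hne j hj hji)]
      omega
  have s1 : Step H B (mix A Q (slots p f)) (mix A Q' (slots p f)) := by
    refine ⟨hI, hI', fun j => ?_⟩
    by_cases hj : j ∈ A
    · simpa [mix, hj] using hmv j hj
    · simp [mix, hj]
  -- Agent `i` could not move to `Q' i` alone, since others may block it at their old positions. So
  -- all agents in `A` advance together; now `i` enters `D` while the others retreat to `Q`.
  have s2 : Step H B (mix A Q' (slots p f)) (update (mix (A.erase i) Q (slots p f)) i d) := by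
    refine ⟨hI', hI'', fun j => ?_⟩
    by_cases hji : j = i
    · subst hji
      right
      simpa [mix, hi] using hid
    · by_cases hj : j ∈ A
      · simp only [mix, hj, if_true, update_of_ne hji, Finset.mem_erase, ne_eq, hji,
          not_false_eq_true, true_and]
        exact (hmv j hj).elim (fun e => Or.inl e.symm) fun e => Or.inr e.symm
      · simp [mix, hj, hji]
  refine (h.rearrange hQ (fun j hj k hk => hF j hj _ (h.mem k hk)) (hgv A) hf).trans ?_
  refine (Reach.eqv (.tail (.single s1) s2)).trans ?_
  refine h.store hK (hQ.mono (Finset.erase_subset _ _)) hFe (by simp) hd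
    (by rwa [Finset.insert_erase hi]) (fun j hj hji => ?_) (hgv _)
  have := (hav j (hne j hj hji)).1
  omega

/-- Each absorption leaves the other agents at `Q`, so it can be repeated for one agent after the
other. -/
theorem Storage.absorb_all (h : Storage H D lam p K) (hK : Fintype.card ι + 4 ≤ K) {Q Q' : ι → V}
    (hQ : IndepOn H B A Q) (hQ' : IndepOn H B A Q') (hF : Far H D A Q)
    (hmv : ∀ j ∈ A, Q' j = Q j ∨ H.Adj (Q j) (Q' j)) (hg : Valid K ∅ g) (E : Finset ι)
    (hE : ∀ i ∈ E, ∃ d ∈ D, H.Adj (Q' i) d) :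
    Eqv H B (mix A Q (slots p g)) (mix (A \ E) Q (slots p g)) := by
  induction E using Finset.induction_on with
  | empty => simpa using Eqv.refl _
  | insert i E hiE ih =>
    refine (ih fun j hj => hE j (Finset.mem_insert_of_mem hj)).trans ?_
    rw [Finset.sdiff_insert]
    by_cases hi : i ∈ A \ E
    · obtain ⟨d, hd, hid⟩ := hE i (Finset.mem_insert_self _ _)
      have hsub : A \ E ⊆ A := Finset.sdiff_subset
      exact h.absorb hK (hQ.mono hsub) (hQ'.mono hsub) (fun j hj => hF j (hsub hj))
        (fun j hj => hmv j (hsub hj)) hi hd hid hg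
    · rw [Finset.erase_eq_of_notMem hi]
      exact Eqv.refl _

open Classical in
/-- The agents that are neither in `D` nor adjacent to `D`. -/
noncomputable def outside (H : SimpleGraph V) (D : Set V) (Q : ι → V) : Finset ι :=
  Finset.univ.filter fun i => ∀ d ∈ D, Sep H (Q i) d

/-- Agents that are outside in `Q` but not in `Q'` are absorbed before the step; by reversibility,
those that are outside in `Q'` but not in `Q` are released after it. In between, the agents that are
outside at both times perform the original move while all stored agents rest. -/
theorem Storage.sim_step (h : Storage H D lam p K) (hK : Fintype.card ι + 4 ≤ K) {Q Q' : ι → V}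
    (hs : Step H (B ∪ D) Q Q') (hg : Valid K ∅ g) :
    Eqv H B (mix (outside H D Q) Q (slots p g)) (mix (outside H D Q') Q' (slots p g)) := by
  -- Stated for an arbitrary pair because it is also applied to the reversed step.
  have aux : ∀ {Q Q' : ι → V}, Step H (B ∪ D) Q Q' →
      IndepOn H B (outside H D Q) Q ∧ IndepOn H B (outside H D Q) Q' ∧
      Far H D (outside H D Q) Q ∧ (∀ j ∈ outside H D Q, Q' j ∉ D) ∧
      Eqv H B (mix (outside H D Q) Q (slots p g))
        (mix (outside H D Q ∩ outside H D Q') Q (slots p g)) := by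
    intro Q Q' hs
    have hF : Far H D (outside H D Q) Q := fun j hj => by simpa [outside] using hj
    have hD : ∀ j ∈ outside H D Q, Q' j ∉ D := fun j hj hjD => by
      have := hF j hj _ hjD
      exact (hs.move j).elim (fun e => this.1 e.symm) this.2
    have hQ : IndepOn H B (outside H D Q) Q := fun i hi j hj hij hiB hjB =>
      hs.left i j hij (fun hh => hh.elim hiB fun h' => (hF i hi _ h').1 rfl)
        (fun hh => hh.elim hjB fun h' => (hF j hj _ h').1 rfl)
    have hQ' : IndepOn H B (outside H D Q) Q' := fun i hi j hj hij hiB hjB =>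
      hs.right i j hij (fun hh => hh.elim hiB (hD i hi)) (fun hh => hh.elim hjB (hD j hj))
    refine ⟨hQ, hQ', hF, hD, ?_⟩
    have := h.absorb_all hK hQ hQ' hF (fun j _ => hs.move j) hg
      (outside H D Q \ outside H D Q') (fun i hi => ?_)
    · rwa [sdiff_sdiff_right_self, Finset.inf_eq_inter] at this
    · rw [Finset.mem_sdiff] at hi
      by_contra hcon
      push Not at hcon
      have : ∀ d ∈ D, Sep H (Q' i) d := fun d hd => ⟨fun e => hD i hi.1 (e ▸ hd), hcon d hd⟩
      exact hi.2 (by simpa [outside] using this)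
  obtain ⟨hQ, hQ', hF, -, r1⟩ := aux hs
  obtain ⟨-, -, hF', -, r2⟩ := aux hs.symm
  rw [Finset.inter_comm] at r2
  refine r1.trans (Eqv.trans (Reach.eqv (.single ?_)) r2.symm)
  have hcc : ∀ j k, j ≠ k → Sep H (slots p g j) (slots p g k) := fun j k hjk =>
    h.slots_sep (hg.1 j (by simp)) (hg.1 k (by simp)) fun he =>
      hjk (hg.2 j (by simp) k (by simp) he)
  have hmem : ∀ k, slots p g k ∈ D := fun k => h.mem _ (by have := hg.1 k (by simp); omega)
  refine ⟨indep_mix (hQ.mono Finset.inter_subset_left)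
    (fun j hj k _ => hF j (Finset.mem_inter.1 hj).1 _ (hmem k)) (fun j _ k _ => hcc j k),
    indep_mix (hQ'.mono Finset.inter_subset_left)
    (fun j hj k _ => hF' j (Finset.mem_inter.1 hj).2 _ (hmem k)) (fun j _ k _ => hcc j k),
    fun j => ?_⟩
  by_cases hj : j ∈ outside H D Q ∩ outside H D Q'
  · simpa only [mix, hj, if_true] using hs.move j
  · simp only [mix, hj, if_false, true_or]

/-- Turning a storage region that is far from the terminals into a black hole does not make an
unsolvable instance solvable. -/
theorem Storage.solv (h : Storage H D lam p (Fintype.card ι + 4)) {S T : Set V}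
    (hS : ∀ v ∈ S, ∀ d ∈ D, Sep H v d) (hT : ∀ v ∈ T, ∀ d ∈ D, Sep H v d)
    (hsol : Solv ι H (B ∪ D) S T) : Solv ι H B S T := by
  obtain ⟨Q, Q', hQS, hQT, hI, hR⟩ := hsol
  let g : ι → ℕ := fun i => Fintype.equivFin ι i
  have hg : Valid (Fintype.card ι + 4) ∅ g :=
    ⟨fun j _ => by have := (Fintype.equivFin ι j).2; simp only [g]; omega,
      fun j _ k _ hjk => (Fintype.equivFin ι).injective (Fin.ext hjk)⟩
  have key : Eqv H B (mix (outside H D Q) Q (slots p g)) (mix (outside H D Q') Q' (slots p g)) := by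
    clear hQT
    induction hR with
    | refl => exact Eqv.refl _
    | tail _ hs ih => exact ih.trans (h.sim_step le_rfl hs hg)
  -- At the terminals nobody is in storage, so there the simulation agrees with the given plan.
  have hall : ∀ {Q : ι → V} {S : Set V}, Set.range Q = S → (∀ v ∈ S, ∀ d ∈ D, Sep H v d) →
      mix (outside H D Q) Q (slots p g) = Q := by
    intro Q S hQS hS
    funext i
    have : i ∈ outside H D Q := by
      simpa [outside] using hS (Q i) (hQS ▸ Set.mem_range_self i)
    simp [mix, this]
  rw [hall hQS hS, hall hQT hT] at key
  obtain ⟨σ, hr⟩ := key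
  refine ⟨Q, Q' ∘ σ, hQS, by rw [σ.surjective.range_comp, hQT], ?_, hr⟩
  intro i j hij hi hj
  have hn : ∀ i, Q i ∉ D := fun i hiD =>
    (hS (Q i) (hQS ▸ Set.mem_range_self i) _ hiD).1 rfl
  exact hI i j hij (fun hh => hh.elim hi (hn i)) (fun hh => hh.elim hj (hn j))

end Storage

/-! ### Changing the black holes and the ambient vertex type -/

section Transfer

variable {V W ι : Type} {H : SimpleGraph V} {B B' S T : Set V}

theorem Indep.mono {Q : ι → V} (h : Indep H B Q) (hB : ∀ i, Q i ∈ B → Q i ∈ B') : Indep H B' Q :=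
  fun i j hij hi hj => h i j hij (fun h' => hi (hB i h')) fun h' => hj (hB j h')

theorem Solv.mono (h : Solv ι H B S T) (hB : B ⊆ B') : Solv ι H B' S T := by
  obtain ⟨Q, Q', hS, hT, hI, hR⟩ := h
  refine ⟨Q, Q', hS, hT, hI.mono fun _ h => hB h, Relation.ReflTransGen.mono ?_ _ _ hR⟩
  exact fun Q Q' h => ⟨h.left.mono fun _ h => hB h, h.right.mono fun _ h => hB h, h.move⟩

/-- Only the black holes in a set that no agent can leave matter. -/
theorem Solv.of_closed {C : Set V} (hC : ∀ u ∈ C, ∀ v, H.Adj u v → v ∈ C) (hSC : S ⊆ C)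
    (hB : ∀ v ∈ C, v ∈ B → v ∈ B') (h : Solv ι H B S T) : Solv ι H B' S T := by
  obtain ⟨Q, Q', hS, hT, hI, hR⟩ := h
  have hQ : ∀ i, Q i ∈ C := fun i => hSC (hS ▸ Set.mem_range_self i)
  refine ⟨Q, Q', hS, hT, hI.mono fun i => hB _ (hQ i), ?_⟩
  have : (∀ i, Q' i ∈ C) ∧ Reach H B' Q Q' := by
    clear hT
    induction hR with
    | refl => exact ⟨hQ, .refl⟩
    | tail _ hs ih =>
      have hQ' := fun i => (hs.move i).elim (fun e => e ▸ ih.1 i) fun e => hC _ (ih.1 i) _ e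
      exact ⟨hQ', ih.2.tail ⟨hs.left.mono fun i => hB _ (ih.1 i),
        hs.right.mono fun i => hB _ (hQ' i), hs.move⟩⟩
  exact this.2

/-- Solvability is invariant under embeddings onto a union of connected components. -/
theorem solv_iff_of_embedding {H' : SimpleGraph W} {C : Set W} (φ : V → W) (hφ : Injective φ)
    (hadj : ∀ u v, H'.Adj (φ u) (φ v) ↔ H.Adj u v) (hB : ∀ v, φ v ∈ C ↔ v ∈ B)
    (hcl : ∀ u y, H'.Adj (φ u) y → y ∈ Set.range φ) :
    Solv ι H B S T ↔ Solv ι H' C (φ '' S) (φ '' T) := by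
  have hI : ∀ Q : ι → V, Indep H' C (φ ∘ Q) ↔ Indep H B Q := by
    intro Q
    simp only [Indep, Sep, comp_apply, hadj, hB, hφ.ne_iff]
  constructor
  · rintro ⟨Q, Q', hS, hT, hQ, hR⟩
    refine ⟨φ ∘ Q, φ ∘ Q', by rw [Set.range_comp, hS], by rw [Set.range_comp, hT], (hI Q).2 hQ, ?_⟩
    clear hT
    induction hR with
    | refl => exact .refl
    | tail _ hs ih =>
      exact ih.tail ⟨(hI _).2 hs.left, (hI _).2 hs.right, fun i => by
        simpa only [comp_apply, hadj, hφ.eq_iff] using hs.move i⟩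
  · rintro ⟨Q, Q', hS, hT, hQ, hR⟩
    have h0 : ∀ i, ∃ v, φ v = Q i := fun i => by
      have : Q i ∈ φ '' S := hS ▸ Set.mem_range_self i
      obtain ⟨v, -, hv⟩ := this
      exact ⟨v, hv⟩
    choose P hP using h0
    obtain rfl : φ ∘ P = Q := funext hP
    have key : ∃ P', Q' = φ ∘ P' ∧ Reach H B P P' := by
      clear hT
      induction hR with
      | refl => exact ⟨P, rfl, .refl⟩
      | @tail _ Q2 _ hs ih =>
        obtain ⟨P1, rfl, h1⟩ := ih
        have h2 : ∀ i, ∃ v, φ v = Q2 i := fun i => (hs.move i).elim (fun e => ⟨P1 i, e.symm⟩)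
          fun e => hcl _ _ e
        choose P2 hP2 using h2
        obtain rfl : φ ∘ P2 = Q2 := funext hP2
        exact ⟨P2, rfl, h1.tail ⟨(hI _).1 hs.left, (hI _).1 hs.right, fun i => by
          simpa only [comp_apply, hadj, hφ.eq_iff] using hs.move i⟩⟩
    obtain ⟨P', rfl, hr⟩ := key
    rw [Set.range_comp, hφ.image_injective.eq_iff] at hS hT
    exact ⟨P, P', hS, hT, (hI P).1 hQ, hr⟩

end Transfer

/-! ### Balls -/

section Ball

variable {V ι : Type} {H : SimpleGraph V} {X : Set V} {u v : V} {t : ℕ}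

/-- The vertices at distance at most `t` from `X`. -/
def ball (H : SimpleGraph V) (X : Set V) : ℕ → Set V
  | 0 => X
  | t + 1 => ball H X t ∪ {v | ∃ u ∈ ball H X t, H.Adj u v}

/-- The distance from `X`, zero for vertices that cannot be reached from `X`. -/
noncomputable def lev (H : SimpleGraph V) (X : Set V) (v : V) : ℕ := sInf {t | v ∈ ball H X t}

theorem ball_mono {s t : ℕ} (h : s ≤ t) : ball H X s ⊆ ball H X t := by
  induction t, h using Nat.le_induction with
  | base => exact subset_rfl
  | succ t _ ih => exact ih.trans Set.subset_union_left

theorem mem_ball_succ (hu : u ∈ ball H X t) (huv : H.Adj u v) : v ∈ ball H X (t + 1) :=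
  Or.inr ⟨u, hu, huv⟩

theorem mem_ball_lev (h : v ∈ ball H X t) : v ∈ ball H X (lev H X v) :=
  Nat.sInf_mem (s := {t | v ∈ ball H X t}) ⟨t, h⟩

theorem lev_le (h : v ∈ ball H X t) : lev H X v ≤ t := Nat.sInf_le h

theorem mem_ball_of_lev_le {s : ℕ} (h : v ∈ ball H X t) (hs : lev H X v ≤ s) : v ∈ ball H X s :=
  ball_mono hs (mem_ball_lev h)

/-- This holds on the whole graph despite the default value: adjacent vertices are either both
reachable from `X` or both of level zero. -/
theorem lev_lip (H : SimpleGraph V) (X : Set V) (u v : V) (huv : H.Adj u v) :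
    lev H X u ≤ lev H X v + 1 := by
  by_cases hv : ∃ t, v ∈ ball H X t
  · obtain ⟨t, ht⟩ := hv
    exact lev_le (mem_ball_succ (mem_ball_lev ht) huv.symm)
  · have : {t | u ∈ ball H X t} = ∅ :=
      Set.eq_empty_of_forall_notMem fun t ht => hv ⟨t + 1, mem_ball_succ ht huv⟩
    simp [lev, this]

theorem exists_pred (h : ∃ t, v ∈ ball H X t) (hv : lev H X v = t + 1) :
    ∃ u, H.Adj u v ∧ u ∈ ball H X t ∧ lev H X u = t := by
  obtain ⟨s, hs⟩ := h
  have h1 := mem_ball_lev hs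
  rw [hv] at h1
  rcases h1 with h1 | ⟨u, hu, huv⟩
  · have := lev_le h1
    omega
  · have h2 := lev_le hu
    have h3 := lev_lip H X v u huv.symm
    exact ⟨u, huv, hu, by omega⟩

/-- Membership in the balls is recorded besides the level, since a level alone does not tell a
vertex of `X` from an unreachable one. -/
theorem exists_geodesic (h : ∃ t, v ∈ ball H X t) (hv : lev H X v = t) :
    ∃ q : ℕ → V, q t = v ∧ (∀ j ≤ t, q j ∈ ball H X j ∧ lev H X (q j) = j) ∧
      ∀ j < t, H.Adj (q j) (q (j + 1)) := by
  induction t generalizing v with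
  | zero =>
    obtain ⟨s, hs⟩ := h
    refine ⟨fun _ => v, rfl, fun j hj => ?_, by simp⟩
    obtain rfl : j = 0 := by omega
    exact ⟨hv ▸ mem_ball_lev hs, hv⟩
  | succ t ih =>
    obtain ⟨u, huv, hu, hut⟩ := exists_pred h hv
    obtain ⟨q, hq, hq1, hq2⟩ := ih ⟨t, hu⟩ hut
    refine ⟨update q (t + 1) v, by simp, fun j hj => ?_, fun j hj => ?_⟩
    · rcases Nat.lt_or_ge t j with h' | h'
      · obtain rfl : j = t + 1 := by omega
        simp only [update_self]
        exact ⟨mem_ball_succ hu huv, hv⟩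
      · rw [update_of_ne (by omega)]
        exact hq1 j h'
    · rw [update_of_ne (by omega)]
      rcases Nat.lt_or_ge j t with h' | h'
      · rw [update_of_ne (by omega)]
        exact hq2 j h'
      · obtain rfl : j = t := by omega
        simpa [hq] using huv

/-- The vertices that can be reached from `x` without entering the neighbourhood of `X`. -/
def region (H : SimpleGraph V) (X : Set V) (x : V) : Set V :=
  {y | Relation.ReflTransGen (fun a b => H.Adj a b ∧ 2 ≤ lev H X b) x y}

theorem two_le_lev_of_mem_region {x y : V} (hx : 2 ≤ lev H X x) (hy : y ∈ region H X x) :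
    2 ≤ lev H X y := by
  rcases Relation.ReflTransGen.cases_tail hy with rfl | ⟨z, -, h⟩
  · exact hx
  · exact h.2

/-- The geodesic to `x` passes through the levels `0, …, 4 * K + 1`. Dropping the first two, which
keeps the region separated from `X`, leaves `4 * K` vertices on which the shifted level counts `0,
…, 4 * K - 1`. The region is connected since walks inside it can be reversed. -/
theorem region_storage {x : V} {K : ℕ} (h : ∃ t, x ∈ ball H X t) (hx : lev H X x = 4 * K + 1)
    (hK : 0 < K) : ∃ p, Storage H (region H X x) (fun v => lev H X v - 2) p K := by
  obtain ⟨q, hq, hq1, hq2⟩ := exists_geodesic h hx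
  have hx2 : 2 ≤ lev H X x := by omega
  have hmem : ∀ j, 2 ≤ j → j ≤ 4 * K + 1 → q j ∈ region H X x := by
    intro j hj hjK
    induction hjK using Nat.decreasingInduction with
    | self => rw [hq]; exact .refl
    | of_succ j hjK ih =>
      exact (ih (by omega)).tail ⟨(hq2 j hjK).symm, by rw [(hq1 j hjK.le).2]; omega⟩
  refine ⟨fun j => q (j + 2), ⟨fun u v huv => ?_, fun j hj => hmem _ (by omega) (by omega),
    fun j hj => ?_, fun j hj => hq2 _ (by omega), fun d hd => ?_⟩⟩
  · have := lev_lip H X u v huv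
    omega
  · rw [(hq1 _ (by omega)).2]; omega
  · have back : ∀ y ∈ region H X x,
        Relation.ReflTransGen (fun a b => H.Adj a b ∧ b ∈ region H X x) y x := by
      intro y hy
      induction hy with
      | refl => exact .refl
      | tail h1 h2 ih => exact .head ⟨h2.1.symm, h1⟩ ih
    have forth : ∀ y ∈ region H X x,
        Relation.ReflTransGen (fun a b => H.Adj a b ∧ b ∈ region H X x) x y := by
      intro y hy
      induction hy with
      | refl => exact .refl
      | tail h1 h2 ih => exact ih.tail ⟨h2.1, .tail h1 h2⟩
    exact (back d hd).trans (forth _ (hmem 2 le_rfl (by omega)))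

/-- All vertices at distance more than `4 * n + 16` from the terminals may be turned into black
holes. -/
theorem solv_iff_blacken [Fintype ι] {B S T : Set V}
    (hfin : {v | ∃ t, v ∈ ball H (S ∪ T) t}.Finite) :
    Solv ι H B S T ↔ Solv ι H (B ∪ (ball H (S ∪ T) (4 * Fintype.card ι + 16))ᶜ) S T := by
  classical
  set X := S ∪ T with hX
  set n := Fintype.card ι with hn
  refine ⟨fun h => h.mono Set.subset_union_left, fun h => ?_⟩
  -- With `K = n + 4` slots, `4 * K + 1` is the first distance beyond the radius `4 * n + 16`. The
  -- regions of different vertices of `Y` may overlap; those that are already black are simply part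
  -- of `B`.
  set Y : Set V := {x | (∃ t, x ∈ ball H X t) ∧ lev H X x = 4 * (n + 4) + 1} with hY
  have hYfin : Y.Finite := hfin.subset fun x hx => hx.1
  have step : ∀ F : Finset V, (∀ x ∈ F, x ∈ Y) →
      Solv ι H (B ∪ ⋃ x ∈ F, region H X x) S T → Solv ι H B S T := by
    intro F
    induction F using Finset.induction_on with
    | empty => intro _ h; simpa using h
    | insert x F _ ih =>
      intro hF hs
      apply ih fun y hy => hF y (Finset.mem_insert_of_mem hy)
      have hx := hF x (Finset.mem_insert_self _ _)
      obtain ⟨p, hp⟩ := region_storage hx.1 hx.2 (by omega)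
      have hsep : ∀ v ∈ X, ∀ d ∈ region H X x, Sep H v d := by
        intro v hv d hd
        apply sep_of_lam (lev_lip H X)
        have h1 := two_le_lev_of_mem_region (by rw [hx.2]; omega) hd
        have h2 : lev H X v ≤ 0 := lev_le hv
        omega
      refine hp.solv (fun v hv => hsep v (Or.inl hv)) (fun v hv => hsep v (Or.inr hv)) ?_
      refine hs.mono ?_
      rw [Finset.set_biUnion_insert, Set.union_assoc, Set.union_comm (region H X x)]
  refine step hYfin.toFinset (fun x hx => by simpa using hx) ?_
  -- Unreachable vertices are never entered. A reachable vertex beyond the radius lies in one of the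
  -- regions, because its geodesic crosses `Y` and stays at high levels from there on.
  refine Solv.of_closed (C := {v | ∃ t, v ∈ ball H X t}) (fun u hu v huv => ?_)
    (fun v hv => ⟨0, Or.inl hv⟩) (fun v hv hvB => ?_) h
  · obtain ⟨t, ht⟩ := hu
    exact ⟨t + 1, mem_ball_succ ht huv⟩
  · rcases hvB with hvB | hvB
    · exact Or.inl hvB
    · right
      have hge : 4 * (n + 4) + 1 ≤ lev H X v := by
        by_contra hcon
        obtain ⟨t, ht⟩ := hv
        exact hvB (mem_ball_of_lev_le ht (by omega))
      obtain ⟨q, hq, hq1, hq2⟩ := exists_geodesic hv rfl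
      simp only [Set.mem_iUnion]
      refine ⟨q (4 * (n + 4) + 1), by simpa using ⟨⟨_, (hq1 _ hge).1⟩, (hq1 _ hge).2⟩, ?_⟩
      have : ∀ j, 4 * (n + 4) + 1 ≤ j → j ≤ lev H X v →
          q j ∈ region H X (q (4 * (n + 4) + 1)) := by
        intro j hj hjv
        induction j, hj using Nat.le_induction with
        | base => exact .refl
        | succ j hj ih =>
          exact (ih (by omega)).tail ⟨hq2 j (by omega), by rw [(hq1 _ hjv).2]; omega⟩
      have := this _ hge le_rfl
      rwa [hq] at this

end Ball

/-! ### Eliminating vertices -/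

section Elim

variable {V ι : Type} {H : SimpleGraph V} {B S T : Set V}

/-- All neighbours of `w` are made adjacent. -/
def elim (H : SimpleGraph V) (w : V) : SimpleGraph V where
  Adj u v := H.Adj u v ∨ (u ≠ v ∧ H.Adj u w ∧ H.Adj w v)
  symm := ⟨fun _ _ h => h.elim (fun h => Or.inl h.symm)
    fun h => Or.inr ⟨h.1.symm, h.2.2.symm, h.2.1.symm⟩⟩
  loopless := ⟨fun _ h => h.elim (fun h => H.irrefl h) fun h => h.1 rfl⟩

/-- The new edges join black holes only, so independence is unaffected. A move along new edges is
replaced by two moves: agents on new edges pass through `w`, which as a black hole holds any number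
of them, and the others wait before taking the second half. -/
theorem solv_elim_iff {w : V} (hw : w ∈ B) (hN : ∀ v, H.Adj w v → v ∈ B) :
    Solv ι H B S T ↔ Solv ι (elim H w) B S T := by
  have hI : ∀ Q : ι → V, Indep (elim H w) B Q ↔ Indep H B Q := by
    intro Q
    refine forall₅_congr fun i j hij hi hj => ?_
    simp only [Sep, elim, not_or, and_congr_right_iff, and_iff_left_iff_imp]
    intro _ _ hc
    exact hj (hN _ hc.2.2)
  constructor
  · rintro ⟨Q, Q', hS, hT, hQ, hR⟩
    refine ⟨Q, Q', hS, hT, (hI Q).2 hQ, Relation.ReflTransGen.mono ?_ _ _ hR⟩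
    exact fun Q Q' h => ⟨(hI _).2 h.left, (hI _).2 h.right, fun i => (h.move i).imp_right Or.inl⟩
  · rintro ⟨Q, Q', hS, hT, hQ, hR⟩
    refine ⟨Q, Q', hS, hT, (hI Q).1 hQ, ?_⟩
    clear hT
    induction hR with
    | refl => exact .refl
    | @tail Q1 Q2 _ hs ih =>
      classical
      let M : ι → V := fun i => if Q2 i = Q1 i ∨ H.Adj (Q1 i) (Q2 i) then Q1 i else w
      have hM : ∀ i, M i = Q1 i ∨ M i = w := fun i => by
        by_cases h : Q2 i = Q1 i ∨ H.Adj (Q1 i) (Q2 i) <;> simp [M, h]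
      have hMI : Indep H B M := by
        have : ∀ i, M i ∉ B → M i = Q1 i := fun i hi =>
          (hM i).resolve_right fun e => hi (e ▸ hw)
        intro i j hij hi hj
        have hi' := this i hi
        have hj' := this j hj
        rw [hi'] at hi ⊢
        rw [hj'] at hj ⊢
        exact (hI _).1 hs.left i j hij hi hj
      refine (ih.tail ⟨(hI _).1 hs.left, hMI, fun i => ?_⟩).tail
        ⟨hMI, (hI _).1 hs.right, fun i => ?_⟩
      · by_cases h : Q2 i = Q1 i ∨ H.Adj (Q1 i) (Q2 i)
        · simp [M, h]
        · right
          rcases hs.move i with h' | h' | h'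
          · exact absurd (Or.inl h') h
          · exact absurd (Or.inr h') h
          · simpa [M, h] using h'.2.1
      · by_cases h : Q2 i = Q1 i ∨ H.Adj (Q1 i) (Q2 i)
        · simp [M, h]
        · right
          rcases hs.move i with h' | h' | h'
          · exact absurd (Or.inl h') h
          · exact absurd (Or.inr h') h
          · simpa [M, h] using h'.2.2

/-- The graph without the edges that meet `W`. -/
def isolate (H : SimpleGraph V) (W : Set V) : SimpleGraph V where
  Adj u v := H.Adj u v ∧ u ∉ W ∧ v ∉ W
  symm := ⟨fun _ _ h => ⟨h.1.symm, h.2.2, h.2.1⟩⟩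
  loopless := ⟨fun _ h => H.irrefl h.1⟩

/-- While an agent is in `W`, its copy waits at a vertex adjacent to its current position. Since
neighbourhoods of vertices in `W` are cliques, this adjacency survives moves inside `W`, and on
leaving `W` the copy catches up by one edge. The waiting vertex is a black hole, so waiting there
disturbs nobody. -/
theorem solv_isolate_iff {W : Set V} (hW : W ⊆ B) (hN : ∀ w ∈ W, ∀ v, H.Adj w v → v ∈ B)
    (hcl : ∀ w ∈ W, ∀ u v, H.Adj w u → H.Adj w v → u ≠ v → H.Adj u v)
    (hSW : ∀ v ∈ S, v ∉ W) (hTW : ∀ v ∈ T, v ∉ W) :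
    Solv ι H B S T ↔ Solv ι (isolate H W) B S T := by
  have hI : ∀ Q : ι → V, Indep (isolate H W) B Q ↔ Indep H B Q := by
    intro Q
    refine forall₅_congr fun i j hij hi hj => ?_
    have h1 : Q i ∉ W := fun h => hi (hW h)
    have h2 : Q j ∉ W := fun h => hj (hW h)
    simp [Sep, isolate, h1, h2]
  constructor
  · rintro ⟨Q, Q', hS, hT, hQ, hR⟩
    have hQW : ∀ i, Q i ∉ W := fun i => hSW _ (hS ▸ Set.mem_range_self i)
    have hQW' : ∀ i, Q' i ∉ W := fun i => hTW _ (hT ▸ Set.mem_range_self i)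
    refine ⟨Q, Q', hS, hT, (hI Q).2 hQ, ?_⟩
    have key : ∃ P, Reach (isolate H W) B Q P ∧ (∀ i, Q' i ∉ W → P i = Q' i) ∧
        ∀ i, Q' i ∈ W → P i ∉ W ∧ H.Adj (P i) (Q' i) := by
      clear hT hQW'
      induction hR with
      | refl => exact ⟨Q, .refl, fun _ _ => rfl, fun i hi => absurd hi (hQW i)⟩
      | @tail Q1 Q2 _ hs ih =>
        classical
        obtain ⟨P, hP, hP1, hP2⟩ := ih
        have hPW : ∀ i, P i ∉ W := fun i => by
          by_cases h : Q1 i ∈ W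
          · exact (hP2 i h).1
          · rwa [hP1 i h]
        have hadj : ∀ i, Q2 i ∈ W → H.Adj (P i) (Q2 i) := by
          intro i hi
          by_cases h : Q1 i ∈ W
          · rcases hs.move i with e | e
            · rw [e]; exact (hP2 i h).2
            · exact hcl _ h _ _ (hP2 i h).2.symm e fun e' => hPW i (e' ▸ hi)
          · rw [hP1 i h]
            exact (hs.move i).resolve_left fun e => h (e ▸ hi)
        refine ⟨fun i => if Q2 i ∈ W then P i else Q2 i, hP.tail ⟨?_, ?_, fun i => ?_⟩,
          fun i hi => by simp [hi], fun i hi => by simpa [hi] using ⟨hPW i, hadj i hi⟩⟩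
        · exact Reach.indep hP ((hI _).2 hQ)
        · have : ∀ i, (if Q2 i ∈ W then P i else Q2 i) ∉ B → Q2 i ∉ W := by
            intro i hi h
            rw [if_pos h] at hi
            exact hi (hN _ h _ (hadj i h).symm)
          intro i j hij hi hj
          have hi' := this i hi
          have hj' := this j hj
          simp only [hi', hj', if_false] at hi hj ⊢
          exact (hI _).2 hs.right i j hij hi hj
        · by_cases h2 : Q2 i ∈ W
          · simp [h2]
          · simp only [h2, if_false]
            by_cases h1 : Q1 i ∈ W
            · have h3 := (hs.move i).resolve_left fun e => h2 (e ▸ h1)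
              by_cases e : Q2 i = P i
              · exact Or.inl e
              · exact Or.inr ⟨hcl _ h1 _ _ (hP2 i h1).2.symm h3 (Ne.symm e), hPW i, h2⟩
            · rw [hP1 i h1]
              exact (hs.move i).imp_right fun e => ⟨e, h1, h2⟩
    obtain ⟨P, hP, hP1, -⟩ := key
    rwa [show P = Q' from funext fun i => hP1 i (hQW' i)] at hP
  · rintro ⟨Q, Q', hS, hT, hQ, hR⟩
    refine ⟨Q, Q', hS, hT, (hI Q).1 hQ, Relation.ReflTransGen.mono ?_ _ _ hR⟩
    exact fun Q Q' h => ⟨(hI _).1 h.left, (hI _).1 h.right, fun i => (h.move i).imp_right And.left⟩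

open Classical in
/-- The vertices of `W` below `k` are eliminated in increasing order. -/
noncomputable def elimUpTo (H : SimpleGraph ℕ) (W : Set ℕ) : ℕ → SimpleGraph ℕ
  | 0 => H
  | k + 1 => if k ∈ W then elim (elimUpTo H W k) k else elimUpTo H W k

variable {H : SimpleGraph ℕ} {W Z B S T : Set ℕ}

/-- A fill-in edge joins two neighbours of an eliminated vertex, and these lie in `Z` whether the
edges to them are old or themselves fill-in. -/
theorem elimUpTo_adj (hN : ∀ w ∈ W, ∀ v, H.Adj w v → v ∈ Z) (k : ℕ) {u v : ℕ}
    (h : (elimUpTo H W k).Adj u v) : H.Adj u v ∨ (u ∈ Z ∧ v ∈ Z) := by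
  induction k generalizing u v with
  | zero => exact Or.inl h
  | succ k ih =>
    by_cases hk : k ∈ W
    · simp only [elimUpTo, hk, if_true] at h
      rcases h with h | ⟨-, h1, h2⟩
      · exact ih h
      · right
        constructor
        · exact (ih h1).elim (fun h => hN k hk _ h.symm) fun h => h.1
        · exact (ih h2).elim (fun h => hN k hk _ h) fun h => h.2
    · simp only [elimUpTo, hk, if_false] at h
      exact ih h

theorem elimUpTo_lt {N : ℕ} (hN : ∀ u v, H.Adj u v → u < N) (k : ℕ) {u v : ℕ}
    (h : (elimUpTo H W k).Adj u v) : u < N := by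
  induction k generalizing u v with
  | zero => exact hN _ _ h
  | succ k ih =>
    by_cases hk : k ∈ W
    · simp only [elimUpTo, hk, if_true] at h
      rcases h with h | ⟨-, h1, -⟩
      · exact ih h
      · exact ih h1
    · simp only [elimUpTo, hk, if_false] at h
      exact ih h

/-- Eliminating `w` makes its neighbourhood a clique, and a later elimination of `k` preserves this:
if `w` is adjacent to `k`, every old neighbour of `w` is `k` or adjacent to `k`, so it gets joined
to the new neighbours, which are neighbours of `k` as well. Eliminated vertices stay in the graph,
hence the separate step `isolate`. -/
theorem elimUpTo_clique (k : ℕ) : ∀ w ∈ W, w < k → ∀ u v, (elimUpTo H W k).Adj w u →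
    (elimUpTo H W k).Adj w v → u ≠ v → (elimUpTo H W k).Adj u v := by
  induction k with
  | zero => intro w _ h; omega
  | succ k ih =>
    intro w hw hwk u v hu hv huv
    by_cases hk : k ∈ W
    · simp only [elimUpTo, hk, if_true] at hu hv ⊢
      rcases Nat.lt_or_ge w k with hlt | hge
      · have ih' := ih w hw hlt
        have key : ∀ {u}, (elimUpTo H W k).Adj w k → (elimUpTo H W k).Adj w u →
            u = k ∨ (elimUpTo H W k).Adj u k := fun {u} h1 h2 => by
          by_cases e : u = k
          · exact Or.inl e
          · exact Or.inr (ih' _ _ h2 h1 e)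
        rcases hu with hu | ⟨-, hu1, hu2⟩ <;> rcases hv with hv | ⟨-, hv1, hv2⟩
        · exact Or.inl (ih' _ _ hu hv huv)
        · rcases key hv1 hu with rfl | h
          · exact Or.inl hv2
          · exact Or.inr ⟨huv, h, hv2⟩
        · rcases key hu1 hv with rfl | h
          · exact Or.inl hu2.symm
          · exact Or.inr ⟨huv, hu2.symm, h.symm⟩
        · exact Or.inr ⟨huv, hu2.symm, hv2⟩
      · obtain rfl : w = k := by omega
        have : ∀ {x}, (elim (elimUpTo H W w) w).Adj w x → (elimUpTo H W w).Adj w x := fun h =>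
          h.elim id fun h => absurd h.2.1 ((elimUpTo H W w).irrefl)
        exact Or.inr ⟨huv, (this hu).symm, this hv⟩
    · simp only [elimUpTo, hk, if_false] at hu hv ⊢
      rcases Nat.lt_or_ge w k with hlt | hge
      · exact ih w hw hlt u v hu hv huv
      · obtain rfl : w = k := by omega
        exact absurd hw hk

theorem solv_elimUpTo_iff (hWZ : W ⊆ Z) (hZB : Z ⊆ B) (hN : ∀ w ∈ W, ∀ v, H.Adj w v → v ∈ Z)
    (k : ℕ) : Solv ι H B S T ↔ Solv ι (elimUpTo H W k) B S T := by
  induction k with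
  | zero => rfl
  | succ k ih =>
    by_cases hk : k ∈ W
    · simp only [elimUpTo, hk, if_true]
      rw [ih, solv_elim_iff (hZB (hWZ hk))]
      exact fun v hv => hZB ((elimUpTo_adj hN k hv).elim (hN k hk v) fun h => h.2)
    · simpa only [elimUpTo, hk, if_false] using ih

end Elim

/-! ### Instances as graphs on the natural numbers -/

section Instance

/-- For radius one the distance within the planets matters only through equality and adjacency. -/
theorem isIndependent_iff {V : Type} {G : GalacticGraph V} {n : ℕ} {Q : Fin n → V} :
    G.IsIndependent 1 Q ↔ Indep G.graph G.blackHoles Q := by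
  refine forall₃_congr fun i j hij => ?_
  have : ∀ (hi : Q i ∈ G.planets) (hj : Q j ∈ G.planets),
      (¬ G.planetDist ⟨Q i, hi⟩ ⟨Q j, hj⟩ ≤ 1) ↔ Sep G.graph (Q i) (Q j) := by
    intro hi hj
    rw [GalacticGraph.planetDist, SimpleGraph.edist_le_one_iff_adj_or_eq]
    simp [Sep, and_comm]
  simp only [Nat.cast_one]
  exact ⟨fun h hi hj => (this hi hj).1 (h hi hj), fun h hi hj => (this hi hj).2 (h hi hj)⟩

theorem exists_seq_of_reach {V ι : Type} {H : SimpleGraph V} {B : Set V} {Q Q' : ι → V}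
    (h : Reach H B Q Q') :
    ∃ (l : ℕ) (P : ℕ → ι → V), P 0 = Q ∧ P l = Q' ∧ ∀ k < l, Step H B (P k) (P (k + 1)) := by
  induction h with
  | refl => exact ⟨0, fun _ => Q, rfl, rfl, by simp⟩
  | @tail Q1 Q2 _ hs ih =>
    obtain ⟨l, P, h0, hl, hP⟩ := ih
    refine ⟨l + 1, update P (l + 1) Q2, by simpa using h0, by simp, fun k hk => ?_⟩
    rw [update_of_ne (by omega)]
    rcases Nat.lt_or_ge k l with h | h
    · rw [update_of_ne (by omega)]
      exact hP k h
    · obtain rfl : k = l := by omega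
      simpa [hl] using hs

theorem solvable_iff (I : GMAPFInstance) {n : ℕ} (hn : I.agents = n) :
    I.Solvable ↔ Solv (Fin n) I.galaxy.graph I.galaxy.blackHoles I.S I.T := by
  subst hn
  constructor
  · rintro ⟨l, Q, hQ⟩
    refine ⟨Q 0, Q l, hQ.start, hQ.target, isIndependent_iff.1 (hQ.independent 0 (Nat.zero_le _)), ?_⟩
    have : ∀ k ≤ l, Reach I.galaxy.graph I.galaxy.blackHoles (Q 0) (Q k) := by
      intro k hk
      induction k with
      | zero => exact .refl
      | succ k ih =>
        exact (ih (by omega)).tail ⟨isIndependent_iff.1 (hQ.independent k (by omega)),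
          isIndependent_iff.1 (hQ.independent _ hk), hQ.move k hk⟩
    exact this l le_rfl
  · rintro ⟨Q, Q', hS, hT, hI, hR⟩
    obtain ⟨l, P, rfl, rfl, hP⟩ := exists_seq_of_reach hR
    refine ⟨l, P, hS, hT, fun k hk => (hP k hk).move, fun k hk => isIndependent_iff.2 ?_⟩
    rcases Nat.lt_or_ge k l with h | h
    · exact (hP k h).left
    · obtain rfl : k = l := by omega
      exact hR.indep hI

variable (I : GMAPFInstance)

/-- The graph of an instance as a graph on the natural numbers. -/
def natGraph : SimpleGraph ℕ := I.galaxy.graph.map Fin.valEmbedding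

/-- A set of vertices of an instance as a set of natural numbers. -/
def natSet {n : ℕ} (s : Set (Fin n)) : Set ℕ := Fin.val '' s

/-- The starting and final positions. -/
def terminals : Set ℕ := natSet (I.S : Set (Fin I.order)) ∪ natSet (I.T : Set (Fin I.order))

/-- The vertices within distance `4 * n + 16` of the terminals. -/
def inner : Set ℕ := ball (natGraph I) (terminals I) (4 * I.agents + 16)

/-- The vertices that are not eliminated. -/
def near : Set ℕ := ball (natGraph I) (terminals I) (4 * I.agents + 17)

open Classical in
/-- The list of the vertices that are not eliminated. -/
noncomputable def kept : List ℕ := (List.range I.order).filter fun v => decide (v ∈ near I)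

/-- The black holes after blackening. -/
def newBlack : Set ℕ := natSet I.galaxy.blackHoles ∪ (inner I)ᶜ

/-- The graph after all eliminations. -/
noncomputable def newGraph : SimpleGraph ℕ := elimUpTo (natGraph I) (near I)ᶜ I.order

variable {I}

theorem mem_natSet {n : ℕ} {s : Set (Fin n)} {v : Fin n} : (v : ℕ) ∈ natSet s ↔ v ∈ s :=
  Fin.val_injective.mem_set_image

theorem natSet_lt {n : ℕ} {s : Set (Fin n)} {v : ℕ} (h : v ∈ natSet s) : v < n := by
  obtain ⟨u, -, rfl⟩ := h
  exact u.2

theorem natGraph_adj {u v : Fin I.order} : (natGraph I).Adj u v ↔ I.galaxy.graph.Adj u v := by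
  rw [natGraph, SimpleGraph.map_adj]
  constructor
  · rintro ⟨u', v', h, hu, hv⟩
    rwa [Fin.val_injective hu, Fin.val_injective hv] at h
  · exact fun h => ⟨u, v, h, rfl, rfl⟩

theorem natGraph_lt (u v : ℕ) (h : (natGraph I).Adj u v) : u < I.order := by
  rw [natGraph, SimpleGraph.map_adj] at h
  obtain ⟨u', v', -, rfl, rfl⟩ := h
  exact u'.2

theorem ball_lt {t v : ℕ} (h : v ∈ ball (natGraph I) (terminals I) t) : v < I.order := by
  cases t with
  | zero => exact h.elim natSet_lt natSet_lt
  | succ t =>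
    induction t with
    | zero =>
      rcases h with h | ⟨u, -, h⟩
      · exact h.elim natSet_lt natSet_lt
      · exact natGraph_lt _ _ h.symm
    | succ t ih =>
      rcases h with h | ⟨u, -, h⟩
      · exact ih h
      · exact natGraph_lt _ _ h.symm

theorem mem_kept {v : ℕ} : v ∈ kept I ↔ v ∈ near I := by
  simp only [kept, List.mem_filter, List.mem_range, decide_eq_true_eq, and_iff_right_iff_imp]
  exact ball_lt

theorem nodup_kept : (kept I).Nodup := List.nodup_range.filter _

theorem inner_subset_near : inner I ⊆ near I := ball_mono (by omega)

theorem terminals_subset_inner : terminals I ⊆ inner I := ball_mono (s := 0) (by omega)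

/-- This is the purpose of the extra layer between `inner` and `near`: all neighbours of eliminated
vertices are black. -/
theorem natGraph_nbr {w v : ℕ} (hw : w ∈ (near I)ᶜ) (h : (natGraph I).Adj w v) : v ∈ (inner I)ᶜ :=
  fun hv => hw (mem_ball_succ hv h.symm)

theorem newGraph_adj {u v : ℕ} (h : (newGraph I).Adj u v) :
    (natGraph I).Adj u v ∨ (u ∈ (inner I)ᶜ ∧ v ∈ (inner I)ᶜ) :=
  elimUpTo_adj (fun _ hw _ h => natGraph_nbr hw h) _ h

open Classical in
/-- The vertices of the kernel that correspond to a set of vertices. -/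
noncomputable def pull (I : GMAPFInstance) (s : Set ℕ) : Finset (Fin (kept I).length) :=
  Finset.univ.filter fun i => (kept I).get i ∈ s

theorem mem_pull {s : Set ℕ} {i : Fin (kept I).length} : i ∈ pull I s ↔ (kept I).get i ∈ s := by
  simp [pull]

theorem image_pull {s : Set ℕ} (hs : s ⊆ terminals I) : (kept I).get '' (pull I s : Set _) = s := by
  ext v
  simp only [Set.mem_image, Finset.mem_coe, mem_pull]
  constructor
  · rintro ⟨i, hi, rfl⟩; exact hi
  · intro hv
    obtain ⟨i, hi⟩ := List.mem_iff_get.1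
      (mem_kept.2 (inner_subset_near (terminals_subset_inner (hs hv))))
    exact ⟨i, hi ▸ hv, hi⟩

theorem card_pull {s : Finset (Fin I.order)} (hs : natSet (s : Set (Fin I.order)) ⊆ terminals I) :
    (pull I (natSet (s : Set (Fin I.order)))).card = s.card := by
  have h1 := image_pull hs
  rw [← Set.ncard_coe_finset, ← Set.ncard_coe_finset s,
    ← Set.ncard_image_of_injective _ (List.nodup_iff_injective_get.1 nodup_kept), h1, natSet,
    Set.ncard_image_of_injective _ Fin.val_injective]

theorem natSet_S_subset : natSet (I.S : Set (Fin I.order)) ⊆ terminals I := Set.subset_union_left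

theorem natSet_T_subset : natSet (I.T : Set (Fin I.order)) ⊆ terminals I := Set.subset_union_right

theorem mem_terminals {v : Fin I.order} : (v : ℕ) ∈ terminals I ↔ v ∈ I.S ∪ I.T := by
  simp [terminals, mem_natSet]

theorem notMem_newBlack {v : ℕ} (hv : v ∈ terminals I) : v ∉ newBlack I := by
  rintro (h | h)
  · obtain ⟨u, hu, rfl⟩ := h
    exact I.subset_planets u (mem_terminals.1 hv) hu
  · exact h (terminals_subset_inner hv)

/-- Fill-in edges avoid the inner ball, and the original neighbours of a terminal are at distance at
most one, where nothing has been blackened. -/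
theorem not_newGraph_adj {v b : ℕ} (hv : v ∈ terminals I) (hb : b ∈ newBlack I) :
    ¬ (newGraph I).Adj v b := by
  intro h
  rcases newGraph_adj h with h | h
  · rcases hb with ⟨b, hb, rfl⟩ | hb
    · have hv' := ball_lt (t := 0) hv
      exact I.not_adj ⟨v, hv'⟩ (mem_terminals.1 hv) b hb (natGraph_adj.1 h)
    · exact hb (ball_mono (s := 1) (by omega) (mem_ball_succ (t := 0) hv h))
  · exact h.1 (terminals_subset_inner hv)

/-- The kernel: all vertices beyond distance `4 * n + 17` from the terminals are eliminated, and the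
vertices at exactly this distance become black holes. -/
noncomputable def kernel (I : GMAPFInstance) : GMAPFInstance where
  order := (kept I).length
  galaxy :=
    { graph := (newGraph I).comap (kept I).get
      blackHoles := {i | (kept I).get i ∈ newBlack I} }
  S := pull I (natSet (I.S : Set (Fin I.order)))
  T := pull I (natSet (I.T : Set (Fin I.order)))
  card_eq := by rw [card_pull natSet_S_subset, card_pull natSet_T_subset, I.card_eq]
  subset_planets v hv := by
    rw [Finset.mem_union, mem_pull, mem_pull] at hv
    exact notMem_newBlack hv
  not_adj v hv b hb := by
    rw [Finset.mem_union, mem_pull, mem_pull] at hv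
    exact not_newGraph_adj hv hb

theorem agents_kernel : (kernel I).agents = I.agents := card_pull natSet_S_subset

/-- Blackening, elimination and isolation all happen on the vertex type `ℕ`; only the two ends of
the chain change the type. Isolation makes the kept vertices closed under adjacency, as the last
embedding requires. -/
theorem solvable_kernel_iff : I.Solvable ↔ (kernel I).Solvable := by
  rw [solvable_iff I rfl, solvable_iff (kernel I) agents_kernel]
  have e1 := solv_iff_of_embedding (ι := Fin I.agents) (H := I.galaxy.graph)
    (B := I.galaxy.blackHoles) (S := (I.S : Set (Fin I.order))) (T := (I.T : Set (Fin I.order)))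
    (H' := natGraph I) (C := natSet I.galaxy.blackHoles) Fin.val Fin.val_injective
    (fun _ _ => natGraph_adj) (fun _ => mem_natSet)
    (fun u y h => ⟨⟨y, natGraph_lt _ _ h.symm⟩, rfl⟩)
  have hfin : {v | ∃ t, v ∈ ball (natGraph I) (terminals I) t}.Finite :=
    (Set.finite_lt_nat I.order).subset fun v ⟨_, ht⟩ => ball_lt ht
  have e2 := solv_iff_blacken (ι := Fin I.agents) (B := natSet I.galaxy.blackHoles) hfin
  rw [Fintype.card_fin] at e2
  have hWZ : (near I)ᶜ ⊆ (inner I)ᶜ := Set.compl_subset_compl.2 inner_subset_near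
  have hZB : (inner I)ᶜ ⊆ newBlack I := Set.subset_union_right
  have e3 := solv_elimUpTo_iff (ι := Fin I.agents) (S := natSet (I.S : Set (Fin I.order)))
    (T := natSet (I.T : Set (Fin I.order))) hWZ hZB (fun _ hw _ h => natGraph_nbr hw h) I.order
  have hnear : ∀ v ∈ terminals I, v ∉ (near I)ᶜ := fun v hv h =>
    h (inner_subset_near (terminals_subset_inner hv))
  have e4 := solv_isolate_iff (ι := Fin I.agents) (H := newGraph I) (B := newBlack I)
    (S := natSet (I.S : Set (Fin I.order))) (T := natSet (I.T : Set (Fin I.order)))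
    (W := (near I)ᶜ) (hWZ.trans hZB)
    (fun w hw v h => hZB ((newGraph_adj h).elim (natGraph_nbr hw) fun h => h.2))
    (fun w hw u v hu hv huv => elimUpTo_clique _ w hw (elimUpTo_lt natGraph_lt _ hu) u v hu hv huv)
    (fun v hv => hnear v (Or.inl hv)) (fun v hv => hnear v (Or.inr hv))
  have e5 := solv_iff_of_embedding (ι := Fin I.agents) (H := (kernel I).galaxy.graph)
    (B := (kernel I).galaxy.blackHoles) (S := ((kernel I).S : Set (Fin (kernel I).order)))
    (T := ((kernel I).T : Set (Fin (kernel I).order)))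
    (H' := isolate (newGraph I) (near I)ᶜ) (C := newBlack I) (kept I).get
    (List.nodup_iff_injective_get.1 nodup_kept)
    (fun u v => by
      have h1 := mem_kept.1 ((kept I).get_mem u)
      have h2 := mem_kept.1 ((kept I).get_mem v)
      exact ⟨fun h => h.1, fun h => ⟨h, fun h' => h' h1, fun h' => h' h2⟩⟩)
    (fun _ => Iff.rfl)
    (fun u y h => by
      have := h.2.2
      rw [Set.notMem_compl_iff, ← mem_kept, List.mem_iff_get] at this
      exact this)
  have i1 := image_pull (I := I) natSet_S_subset
  have i2 := image_pull (I := I) natSet_T_subset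
  rw [show Set.image (α := Fin (kernel I).order) (kept I).get (kernel I).S = _ from i1,
    show Set.image (α := Fin (kernel I).order) (kept I).get (kernel I).T = _ from i2] at e5
  exact e1.trans (e2.trans (e3.trans (e4.trans e5.symm)))

/-! ### The number of vertices of the kernel -/

/-- Coordinates change by at most one along an edge, so each vertex of `F` is determined by some
nearby element of `X` together with an offset in a square of side `2 * t + 1`. -/
theorem card_ball_le {V : Type} {H : SimpleGraph V} {X : Finset V} (x y : V → ℤ)
    (hadj : ∀ u v, H.Adj u v → |x u - x v| ≤ 1 ∧ |y u - y v| ≤ 1) (t : ℕ) (F : Finset V)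
    (hF : ∀ v ∈ F, v ∈ ball H X t) (hinj : ∀ u ∈ F, ∀ v ∈ F, x u = x v → y u = y v → u = v) :
    F.card ≤ X.card * ((2 * t + 1) * (2 * t + 1)) := by
  have key : ∀ t, ∀ v ∈ ball H X t, ∃ s ∈ X, |x v - x s| ≤ t ∧ |y v - y s| ≤ t := by
    intro t
    induction t with
    | zero => intro v hv; exact ⟨v, hv, by simp, by simp⟩
    | succ t ih =>
      rintro v (hv | ⟨u, hu, huv⟩)
      · obtain ⟨s, hs, h1, h2⟩ := ih v hv
        exact ⟨s, hs, by push_cast; omega, by push_cast; omega⟩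
      · obtain ⟨s, hs, h1, h2⟩ := ih u hu
        obtain ⟨h3, h4⟩ := hadj u v huv
        rw [abs_le] at h1 h2 h3 h4
        refine ⟨s, hs, abs_le.2 ⟨?_, ?_⟩, abs_le.2 ⟨?_, ?_⟩⟩ <;> push_cast <;> omega
  choose! s hs hx hy using fun v hv => key t v (hF v hv)
  have hcard : (X ×ˢ (Finset.Icc (-t : ℤ) t ×ˢ Finset.Icc (-t : ℤ) t)).card =
      X.card * ((2 * t + 1) * (2 * t + 1)) := by
    simp only [Finset.card_product, Int.card_Icc]
    congr 2 <;> omega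
  rw [← hcard]
  refine Finset.card_le_card_of_injOn (fun v => (s v, x v - x (s v), y v - y (s v))) ?_ ?_
  · intro v hv
    have h1 := abs_le.1 (hx v hv)
    have h2 := abs_le.1 (hy v hv)
    simp only [Finset.coe_product, Set.mem_prod, Finset.mem_coe, Finset.mem_Icc]
    exact ⟨hs v hv, h1, h2⟩
  · intro u hu v hv huv
    simp only [Prod.mk.injEq] at huv
    obtain ⟨h1, h2, h3⟩ := huv
    rw [h1] at h2 h3
    exact hinj u hu v hv (by omega) (by omega)

theorem order_kernel_le (hI : I.IsInducedGrid) : (kernel I).order ≤ 3698 * I.agents ^ 3 := by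
  classical
  obtain ⟨a, b, ⟨f⟩⟩ := hI
  let x : ℕ → ℤ := fun v => if h : v < I.order then ((f ⟨v, h⟩).1 : ℕ) else 0
  let y : ℕ → ℤ := fun v => if h : v < I.order then ((f ⟨v, h⟩).2 : ℕ) else 0
  have hadj : ∀ u v, (natGraph I).Adj u v → |x u - x v| ≤ 1 ∧ |y u - y v| ≤ 1 := by
    intro u v huv
    have hu := natGraph_lt _ _ huv
    have hv := natGraph_lt _ _ huv.symm
    have h := f.map_rel_iff.2 (natGraph_adj (u := ⟨u, hu⟩) (v := ⟨v, hv⟩).1 huv)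
    rw [SimpleGraph.boxProd_adj] at h
    simp only [x, y, hu, hv, dite_true, abs_le]
    rcases h with ⟨h, h'⟩ | ⟨h, h'⟩ <;> rw [SimpleGraph.pathGraph_adj] at h <;> rw [h'] <;> omega
  let X : Finset ℕ := I.S.image Fin.val ∪ I.T.image Fin.val
  have hX : (X : Set ℕ) = terminals I := by simp [X, terminals, natSet]
  have hXc : X.card ≤ 2 * I.agents := by
    refine (Finset.card_union_le _ _).trans ?_
    have h1 : (I.S.image Fin.val).card ≤ I.S.card := Finset.card_image_le
    have h2 : (I.T.image Fin.val).card ≤ I.T.card := Finset.card_image_le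
    have h3 := I.card_eq
    simp only [GMAPFInstance.agents]
    omega
  have h1 := card_ball_le (X := X) x y hadj (4 * I.agents + 17) (kept I).toFinset
    (fun v hv => by rw [hX]; exact mem_kept.1 (List.mem_toFinset.1 hv))
    (fun u hu v hv h1 h2 => by
      have hu := ball_lt (mem_kept.1 (List.mem_toFinset.1 hu))
      have hv := ball_lt (mem_kept.1 (List.mem_toFinset.1 hv))
      simp only [x, y, hu, hv, dite_true, Nat.cast_inj, Fin.val_inj] at h1 h2
      have := f.injective (Prod.ext h1 h2)
      exact congrArg Fin.val this)
  rw [List.toFinset_card_of_nodup nodup_kept] at h1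
  refine h1.trans ?_
  generalize I.agents = n at *
  -- Without agents there are no terminals and the ball is empty. Otherwise the side `8 * n + 35` is
  -- at most `43 * n`, and `2 * 43 ^ 2 = 3698`.
  rcases Nat.eq_zero_or_pos n with rfl | hn
  · have : X.card = 0 := by omega
    simp [this]
  · calc X.card * ((2 * (4 * n + 17) + 1) * (2 * (4 * n + 17) + 1))
        ≤ (2 * n) * ((43 * n) * (43 * n)) := by gcongr <;> omega
      _ = 3698 * n ^ 3 := by ring

/-! ### Encodings -/

open Classical in
/-- The bit string that encodes the graph induced by `H` on the vertices in the list `l`. -/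
noncomputable def encList (l : List ℕ) (b s t : Set ℕ) (H : SimpleGraph ℕ) : List Bool :=
  List.replicate l.length true ++ [false] ++ l.flatMap fun v =>
    [decide (v ∈ b), decide (v ∈ s), decide (v ∈ t)] ++ l.map fun u => decide (H.Adj v u)

/-- Brings the input and the output to one format over `ℕ`, so that the program can be verified
without any `Fin` types. -/
theorem encode_eq_encList (I : GMAPFInstance) (φ : Fin I.order → ℕ) {l : List ℕ}
    {b s t : Set ℕ} {H : SimpleGraph ℕ} (hl : (List.finRange I.order).map φ = l)
    (hb : ∀ v, v ∈ I.galaxy.blackHoles ↔ φ v ∈ b) (hs : ∀ v, v ∈ I.S ↔ φ v ∈ s)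
    (ht : ∀ v, v ∈ I.T ↔ φ v ∈ t) (hH : ∀ u v, I.galaxy.graph.Adj u v ↔ H.Adj (φ u) (φ v)) :
    I.encode = encList l b s t H := by
  subst hl
  simp only [GMAPFInstance.encode, encList, List.length_map, List.length_finRange,
    List.flatMap_map, List.map_map, comp_def]
  refine congrArg (_ ++ ·) (congrArg (fun g => List.flatMap g _) (funext fun v => ?_))
  rw [decide_eq_decide.2 (hb v), decide_eq_decide.2 (hs v), decide_eq_decide.2 (ht v)]
  exact congrArg (_ ++ ·) (congrArg (fun g => List.map g _) (funext fun u =>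
    decide_eq_decide.2 (hH v u)))

theorem encode_eq (I : GMAPFInstance) :
    I.encode = encList (List.range I.order) (natSet I.galaxy.blackHoles)
      (natSet (I.S : Set (Fin I.order))) (natSet (I.T : Set (Fin I.order))) (natGraph I) :=
  encode_eq_encList I Fin.val List.map_coe_finRange_eq_range (fun _ => mem_natSet.symm)
    (fun _ => by rw [mem_natSet, Finset.mem_coe]) (fun _ => by rw [mem_natSet, Finset.mem_coe])
    (fun _ _ => natGraph_adj.symm)

theorem encode_kernel (I : GMAPFInstance) :
    (kernel I).encode = encList (kept I) (newBlack I) (natSet (I.S : Set (Fin I.order)))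
      (natSet (I.T : Set (Fin I.order))) (newGraph I) :=
  encode_eq_encList (kernel I) (kept I).get (List.map_get_finRange _) (fun _ => Iff.rfl)
    (fun _ => mem_pull) (fun _ => mem_pull) (fun _ _ => Iff.rfl)

theorem length_encList (l : List ℕ) (b s t : Set ℕ) (H : SimpleGraph ℕ) :
    (encList l b s t H).length = l.length + 1 + l.length * (l.length + 3) := by
  simp [encList, List.length_flatMap]
  ring

end Instance

end Galactic

/-! ### Weakest preconditions and running times of programs -/

namespace RAM

/-- The registers that a program may write to. -/
def Prog.writes : Prog → List ℕ
  | .skip => []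
  | .const d _ => [d]
  | .copy d _ => [d]
  | .add d _ _ => [d]
  | .sub d _ _ => [d]
  | .load d _ => [d]
  | .store _ _ => []
  | .seq p q => p.writes ++ q.writes
  | .cond _ p q => p.writes ++ q.writes
  | .loop _ p => p.writes

/-- A bound for the running time of a program in which every loop is iterated at most `M` times. -/
def Prog.cost (M : ℕ) : Prog → ℕ
  | .skip => 1
  | .const _ _ => 1
  | .copy _ _ => 1
  | .add _ _ _ => 1
  | .sub _ _ _ => 1
  | .load _ _ => 1
  | .store _ _ => 1
  | .seq p q => p.cost M + q.cost M
  | .cond _ p q => p.cost M + q.cost M + 1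
  | .loop _ p => M * (p.cost M + 1) + 1

/-- A condition on the initial state that guarantees that the program halts in a state that satisfies
`Q`, with every loop being iterated at most `M` times. -/
def wp (M : ℕ) : Prog → (State → Prop) → State → Prop
  | .skip, Q, s => Q s
  | .const d k, Q, s => Q (s.setReg d k)
  | .copy d a, Q, s => Q (s.setReg d (s.reg a))
  | .add d a b, Q, s => Q (s.setReg d (s.reg a + s.reg b))
  | .sub d a b, Q, s => Q (s.setReg d (s.reg a - s.reg b))
  | .load d a, Q, s => Q (s.setReg d (s.mem (s.reg a)))
  | .store a b, Q, s => Q (s.setMem (s.reg a) (s.reg b))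
  | .seq p q, Q, s => wp M p (wp M q Q) s
  | .cond a p q, Q, s => (s.reg a ≠ 0 → wp M p Q s) ∧ (s.reg a = 0 → wp M q Q s)
  | .loop a p, Q, s => ∃ (I : ℕ → State → Prop) (k : ℕ), k ≤ M ∧ I k s ∧
      (∀ j s, I (j + 1) s → s.reg a ≠ 0 ∧ wp M p (I j) s) ∧ ∀ s, I 0 s → s.reg a = 0 ∧ Q s

/-- The loop invariant is indexed by the number of remaining iterations, so it proves termination
and bounds the time at once. -/
theorem exists_runs_of_wp {M : ℕ} {p : Prog} {Q : State → Prop} {s : State} (h : wp M p Q s) :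
    ∃ s' t, t ≤ p.cost M ∧ Runs p s s' t ∧ Q s' := by
  induction p generalizing Q s with
  | skip => exact ⟨_, 1, le_rfl, .skip s, h⟩
  | const d k => exact ⟨_, 1, le_rfl, .const d k s, h⟩
  | copy d a => exact ⟨_, 1, le_rfl, .copy d a s, h⟩
  | add d a b => exact ⟨_, 1, le_rfl, .add d a b s, h⟩
  | sub d a b => exact ⟨_, 1, le_rfl, .sub d a b s, h⟩
  | load d a => exact ⟨_, 1, le_rfl, .load d a s, h⟩
  | store a b => exact ⟨_, 1, le_rfl, .store a b s, h⟩
  | seq p q ihp ihq =>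
    obtain ⟨s', t, ht, hr, h'⟩ := ihp h
    obtain ⟨s'', t', ht', hr', h''⟩ := ihq h'
    exact ⟨s'', t + t', Nat.add_le_add ht ht', .seq hr hr', h''⟩
  | cond a p q ihp ihq =>
    by_cases ha : s.reg a = 0
    · obtain ⟨s', t, ht, hr, h'⟩ := ihq (h.2 ha)
      exact ⟨s', t + 1, by simp only [Prog.cost]; omega, .condFalse ha hr, h'⟩
    · obtain ⟨s', t, ht, hr, h'⟩ := ihp (h.1 ha)
      exact ⟨s', t + 1, by simp only [Prog.cost]; omega, .condTrue ha hr, h'⟩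
  | loop a p ih =>
    obtain ⟨I, k, hk, hI, hs, h0⟩ := h
    have key : ∀ k s, I k s → ∃ s' t, t ≤ k * (p.cost M + 1) + 1 ∧
        Runs (.loop a p) s s' t ∧ Q s' := by
      intro k
      induction k with
      | zero => exact fun s hs => ⟨s, 1, by omega, .loopDone (h0 s hs).1, (h0 s hs).2⟩
      | succ k ihk =>
        intro s hIs
        obtain ⟨ha, hw⟩ := hs k s hIs
        obtain ⟨s', t, ht, hr, h'⟩ := ih hw
        obtain ⟨s'', t', ht', hr', h''⟩ := ihk s' h'
        exact ⟨s'', t + t' + 1, by rw [Nat.add_one_mul]; omega, .loopStep ha hr hr', h''⟩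
    obtain ⟨s', t, ht, hr, h'⟩ := key k s hI
    refine ⟨s', t, ht.trans ?_, hr, h'⟩
    simp only [Prog.cost]
    gcongr

theorem exists_cost_polynomial (p : Prog) : ∃ q : Polynomial ℕ, ∀ M, p.cost M = q.eval M := by
  induction p with
  | seq p q ihp ihq =>
    obtain ⟨f, hf⟩ := ihp
    obtain ⟨g, hg⟩ := ihq
    exact ⟨f + g, fun M => by simp [Prog.cost, hf, hg]⟩
  | cond a p q ihp ihq =>
    obtain ⟨f, hf⟩ := ihp
    obtain ⟨g, hg⟩ := ihq
    exact ⟨f + g + 1, fun M => by simp [Prog.cost, hf, hg]⟩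
  | loop a p ih =>
    obtain ⟨f, hf⟩ := ih
    exact ⟨Polynomial.X * (f + 1) + 1, fun M => by simp [Prog.cost, hf]⟩
  | _ => exact ⟨1, fun M => by simp [Prog.cost]⟩

theorem wp_mono {M : ℕ} {p : Prog} {Q Q' : State → Prop} {s : State} (h : wp M p Q s)
    (hQ : ∀ s', Q s' → Q' s') : wp M p Q' s := by
  induction p generalizing Q Q' s with
  | seq p q ihp ihq => exact ihp h fun s' h' => ihq h' hQ
  | cond a p q ihp ihq => exact ⟨fun ha => ihp (h.1 ha) hQ, fun ha => ihq (h.2 ha) hQ⟩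
  | loop a p ih =>
    obtain ⟨I, k, hk, hI, hs, h0⟩ := h
    exact ⟨I, k, hk, hI, hs, fun s hs => ⟨(h0 s hs).1, hQ _ (h0 s hs).2⟩⟩
  | _ => exact hQ _ h

/-- Registers outside of `l` agree. -/
def Frame (l : List ℕ) (s s' : State) : Prop := ∀ r ∉ l, s'.reg r = s.reg r

theorem frame_setReg (s : State) (d x : ℕ) : Frame [d] s (s.setReg d x) := by
  intro r hr
  exact update_of_ne (by simpa using hr) _ _

/-- Registers that do not occur as a destination keep their values. Adding this to every
postcondition spares the loop invariants from listing what is unchanged. -/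
theorem wp_frame {M : ℕ} {p : Prog} {Q : State → Prop} {s : State} (h : wp M p Q s) :
    wp M p (fun s' => Q s' ∧ Frame p.writes s s') s := by
  induction p generalizing Q s with
  | seq p q ihp ihq =>
    refine wp_mono (p := p) (ihp h) fun s' h' => wp_mono (p := q) (ihq h'.1) fun s'' h'' => ⟨h''.1, fun r hr => ?_⟩
    simp only [Prog.writes, List.mem_append, not_or] at hr
    rw [h''.2 r hr.2, h'.2 r hr.1]
  | cond a p q ihp ihq =>
    refine ⟨fun ha => wp_mono (ihp (h.1 ha)) fun s' h' => ⟨h'.1, fun r hr => h'.2 r ?_⟩,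
      fun ha => wp_mono (ihq (h.2 ha)) fun s' h' => ⟨h'.1, fun r hr => h'.2 r ?_⟩⟩ <;>
    · simp only [Prog.writes, List.mem_append, not_or] at hr
      first | exact hr.1 | exact hr.2
  | loop a p ih =>
    obtain ⟨I, k, hk, hI, hs, h0⟩ := h
    refine ⟨fun j s' => I j s' ∧ Frame p.writes s s', k, hk, ⟨hI, fun _ _ => rfl⟩, fun j s' h' => ?_,
      fun s' h' => ⟨(h0 s' h'.1).1, (h0 s' h'.1).2, h'.2⟩⟩
    refine ⟨(hs j s' h'.1).1, wp_mono (ih (hs j s' h'.1).2) fun s'' h'' => ⟨h''.1, fun r hr => ?_⟩⟩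
    rw [h''.2 r hr, h'.2 r hr]
  | skip => exact ⟨h, fun _ _ => rfl⟩
  | store a b => exact ⟨h, fun _ _ => rfl⟩
  | _ => exact ⟨h, frame_setReg _ _ _⟩

theorem wp_seq {M : ℕ} {p q : Prog} {R Q : State → Prop} {s : State} (h : wp M p R s)
    (h' : ∀ s', R s' → Frame p.writes s s' → wp M q Q s') : wp M (.seq p q) Q s :=
  wp_mono (p := p) (wp_frame h) fun s' hs => h' s' hs.1 hs.2

@[simp] theorem reg_setReg (s : State) (d x r : ℕ) :
    (s.setReg d x).reg r = if r = d then x else s.reg r := update_apply _ _ _ _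

@[simp] theorem mem_setReg (s : State) (d x : ℕ) : (s.setReg d x).mem = s.mem := rfl

@[simp] theorem reg_setMem (s : State) (a x : ℕ) : (s.setMem a x).reg = s.reg := rfl

@[simp] theorem mem_setMem (s : State) (a x : ℕ) : (s.setMem a x).mem = update s.mem a x := rfl

/-- For `r_i` from `0` to `r_k - 1` do `body`. The register `c` counts down, and register `1` has to
hold `1`. -/
def forLoop (i c k : ℕ) (body : Prog) : Prog :=
  .seq (.const i 0) (.seq (.copy c k)
    (.loop c (.seq body (.seq (.add i i 1) (.sub c c 1)))))

/-- `Inv` is indexed by the completed iterations, whereas the invariant in `wp` counts the remaining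
ones; the two indices add up to the bound. `hstab` is needed because the counters are updated after
the body. -/
theorem wp_forLoop {M i c k : ℕ} {body : Prog} {s : State} {Q : State → Prop}
    (Inv : ℕ → State → Prop) (hne : i ≠ c ∧ k ≠ i ∧ i ≠ 1 ∧ c ≠ 1)
    (hw : i ∉ body.writes ∧ c ∉ body.writes ∧ 1 ∉ body.writes) (h1 : s.reg 1 = 1)
    (hM : s.reg k ≤ M)
    (hstab : ∀ j s x, Inv j s → Inv j (s.setReg i x) ∧ Inv j (s.setReg c x)) (h0 : Inv 0 s)
    (hstep : ∀ j s', j < s.reg k → s'.reg i = j → Frame (i :: c :: body.writes) s s' → Inv j s' →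
      wp M body (Inv (j + 1)) s')
    (hQ : ∀ s', Inv (s.reg k) s' → Q s') : wp M (forLoop i c k body) Q s := by
  obtain ⟨hic, hki, hi1, hc1⟩ := hne
  obtain ⟨hwi, hwc, hw1⟩ := hw
  refine ⟨fun j s' => ∃ j', j + j' = s.reg k ∧ s'.reg i = j' ∧ s'.reg c = j ∧
    Frame (i :: c :: body.writes) s s' ∧ Inv j' s', s.reg k, hM, ?_, ?_, ?_⟩
  · refine ⟨0, by simp, by simp [hic], by simp [hki], fun r hr => ?_, ?_⟩
    · simp only [List.mem_cons, not_or] at hr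
      simp [hr.1, hr.2.1]
    · exact (hstab _ _ _ (hstab _ _ _ h0).1).2
  · rintro j s' ⟨j', hj, hi, hc, hf, hI⟩
    refine ⟨by omega, ?_⟩
    have := hstep j' s' (by omega) hi hf hI
    refine wp_mono (p := body) (wp_frame this) fun s'' h'' => ?_
    obtain ⟨hI'', hf''⟩ := h''
    have e1 : s''.reg 1 = 1 := by
      rw [hf'' 1 hw1, hf 1 (by simp [hi1.symm, hc1.symm, hw1]), h1]
    have ei := hf'' i hwi
    have ec := hf'' c hwc
    refine ⟨j' + 1, by omega, ?_, ?_, fun r hr => ?_, ?_⟩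
    · simp [hic, ei, e1, hi]
    · simp [hic.symm, hi1.symm, ec, e1, hc]
    · have hr' := hr
      simp only [List.mem_cons, not_or] at hr'
      simp only [reg_setReg, hr'.1, hr'.2.1, if_false]
      rw [hf'' r hr'.2.2, hf r hr]
    · exact (hstab _ _ _ (hstab _ _ _ hI'').1).2
  · rintro s' ⟨j', hj, hi, hc, hf, hI⟩
    refine ⟨hc, hQ s' ?_⟩
    obtain rfl : j' = s.reg k := by omega
    exact hI

end RAM

namespace Galactic

open RAM

/-! ### The memory layout -/

local infixr:60 " ;; " => Prog.seq

open Classical in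
/-- The truth value of a proposition as a number. -/
noncomputable def bit (p : Prop) : ℕ := if p then 1 else 0

theorem bit_eq_zero {p : Prop} : bit p = 0 ↔ ¬ p := by simp [bit]

theorem bit_ne_zero {p : Prop} : bit p ≠ 0 ↔ p := by simp [bit]

theorem bit_true {p : Prop} (h : p) : bit p = 1 := by simp [bit, h]

theorem bit_decide (p : Prop) [Decidable p] : (decide p).toNat = bit p := by
  by_cases h : p <;> simp [bit, h]

/-- The address of the `v`-th row in the encoding of a graph with `N` vertices. -/
def row (N v : ℕ) : ℕ := N + 1 + v * (N + 3)

theorem row_succ (N v : ℕ) : row N (v + 1) = row N v + (N + 3) := by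
  simp only [row, Nat.add_one_mul]; omega

theorem row_add_le {N u v : ℕ} (h : u < v) : row N u + (N + 3) ≤ row N v := by
  rw [← row_succ]
  simp only [row]
  have := Nat.mul_le_mul_right (N + 3) (show u + 1 ≤ v from h)
  omega

theorem lt_row (N v : ℕ) : N < row N v := by simp only [row]; omega

/-- A row has `N + 3` cells, so an address determines row and column. The case of row `N`, just
behind the input, covers the marks. -/
theorem row_ne {N u v c d : ℕ} (hc : c < N + 3) (hd : d < N + 3) (h : u ≠ v ∨ c ≠ d) :
    row N u + c ≠ row N v + d := by
  rcases lt_trichotomy u v with h' | rfl | h'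
  · have := row_add_le (N := N) h'; omega
  · omega
  · have := row_add_le (N := N) h'; omega

/-- The memory `m` holds the sets `b`, `s`, `t` and the adjacency relation `a` in the layout of the
input, followed by the marks `mk`. -/
structure Rep (N : ℕ) (b s t : Set ℕ) (a : ℕ → ℕ → Prop) (mk : ℕ → ℕ) (m : ℕ → ℕ) : Prop where
  black : ∀ v < N, m (row N v) = bit (v ∈ b)
  start : ∀ v < N, m (row N v + 1) = bit (v ∈ s)
  target : ∀ v < N, m (row N v + 2) = bit (v ∈ t)
  adj : ∀ u < N, ∀ v < N, m (row N u + 3 + v) = bit (a u v)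
  mark : ∀ v < N, m (row N N + v) = mk v

variable {N M : ℕ} {b st tt : Set ℕ} {a a' : ℕ → ℕ → Prop} {mk mk' : ℕ → ℕ} {m : ℕ → ℕ}
  {s s' : State}

theorem Rep.congr (h : Rep N b st tt a mk m) (ha : ∀ u < N, ∀ v < N, a u v ↔ a' u v)
    (hm : ∀ v < N, mk v = mk' v) : Rep N b st tt a' mk' m :=
  ⟨h.black, h.start, h.target,
    fun u hu v hv => (h.adj u hu v hv).trans (congrArg bit (propext (ha u hu v hv))),
    fun v hv => (h.mark v hv).trans (hm v hv)⟩

theorem Rep.set_mark (h : Rep N b st tt a mk m) {v : ℕ} (hv : v < N) (x : ℕ) :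
    Rep N b st tt a (update mk v x) (update m (row N N + v) x) := by
  have key : ∀ u < N, ∀ c < N + 3, row N u + c ≠ row N N + v := fun u hu c hc =>
    row_ne hc (by omega) (Or.inl hu.ne)
  refine ⟨fun u hu => ?_, fun u hu => ?_, fun u hu => ?_, fun u hu w hw => ?_, fun u hu => ?_⟩
  · rw [update_of_ne (show row N u ≠ _ from key u hu 0 (by omega)), h.black u hu]
  · rw [update_of_ne (key u hu 1 (by omega)), h.start u hu]
  · rw [update_of_ne (key u hu 2 (by omega)), h.target u hu]
  · rw [update_of_ne (by have := key u hu (3 + w) (by omega); omega), h.adj u hu w hw]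
  · by_cases huv : u = v
    · subst huv; simp
    · rw [update_of_ne (by omega), update_of_ne huv, h.mark u hu]

theorem Rep.set_adj (h : Rep N b st tt a mk m) {x y : ℕ} (hx : x < N) (hy : y < N) :
    Rep N b st tt (fun u v => a u v ∨ (u = x ∧ v = y)) mk (update m (row N x + 3 + y) 1) := by
  have key : ∀ u, ∀ c < N + 3, u ≠ x ∨ c ≠ 3 + y → row N u + c ≠ row N x + (3 + y) :=
    fun u c hc h => row_ne hc (by omega) h
  refine ⟨fun u hu => ?_, fun u hu => ?_, fun u hu => ?_, fun u hu w hw => ?_, fun u hu => ?_⟩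
  · rw [update_of_ne (by have := key u 0 (by omega) (by omega); omega), h.black u hu]
  · rw [update_of_ne (by have := key u 1 (by omega) (by omega); omega), h.start u hu]
  · rw [update_of_ne (by have := key u 2 (by omega) (by omega); omega), h.target u hu]
  · by_cases hux : u = x ∧ w = y
    · obtain ⟨rfl, rfl⟩ := hux
      simp [bit]
    · rw [update_of_ne (by have := key u (3 + w) (by omega) (by omega); omega), h.adj u hu w hw]
      simp [hux]
  · rw [update_of_ne (by have := key N u (by omega) (by omega); omega), h.mark u hu]

/-- The marks end before `row N N + N`, and `N < row N N`, so the cells from `2 * row N N` on are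
free for the output. -/
theorem Rep.set_high (h : Rep N b st tt a mk m) {z : ℕ} (hz : 2 * row N N ≤ z) (x : ℕ) :
    Rep N b st tt a mk (update m z x) := by
  have key : ∀ u < N, ∀ c < N + 3, row N u + c ≠ z := fun u hu c hc => by
    have := row_add_le (N := N) hu
    have := lt_row N N
    omega
  refine ⟨fun u hu => ?_, fun u hu => ?_, fun u hu => ?_, fun u hu w hw => ?_, fun u hu => ?_⟩
  · rw [update_of_ne (show row N u ≠ _ from key u hu 0 (by omega)), h.black u hu]
  · rw [update_of_ne (key u hu 1 (by omega)), h.start u hu]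
  · rw [update_of_ne (key u hu 2 (by omega)), h.target u hu]
  · rw [update_of_ne (by have := key u hu (3 + w) (by omega); omega), h.adj u hu w hw]
  · rw [update_of_ne (by have := lt_row N N; omega), h.mark u hu]

/-- The registers that hold the parameters of the layout. -/
structure Ctx (N M : ℕ) (s : State) : Prop where
  one : s.reg 1 = 1
  order : s.reg 2 = N
  width : s.reg 3 = N + 3
  marks : s.reg 4 = row N N
  out : s.reg 5 = 2 * row N N
  header : s.reg 8 = N + 1
  three : s.reg 19 = 3
  le : N ≤ M

theorem Ctx.frame (h : Ctx N M s) {l : List ℕ} (hf : Frame l s s')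
    (hl : ∀ r ∈ [1, 2, 3, 4, 5, 8, 19], r ∉ l) : Ctx N M s' := by
  simp only [List.mem_cons, List.not_mem_nil, or_false, forall_eq_or_imp, forall_eq] at hl
  obtain ⟨h1, h2, h3, h4, h5, h8, h19⟩ := hl
  exact ⟨(hf 1 h1).trans h.one, (hf 2 h2).trans h.order, (hf 3 h3).trans h.width,
    (hf 4 h4).trans h.marks, (hf 5 h5).trans h.out, (hf 8 h8).trans h.header,
    (hf 19 h19).trans h.three, h.le⟩

/-! ### Computing distances -/

open Classical in
/-- The unmarked vertices in `P` receive the mark `x`. -/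
noncomputable def spread (x : ℕ) (mk : ℕ → ℕ) (P : ℕ → Prop) (v : ℕ) : ℕ :=
  if mk v = 0 ∧ P v then x else mk v

theorem spread_congr {x : ℕ} {mk : ℕ → ℕ} {P P' : ℕ → Prop} {v : ℕ} (h : P v ↔ P' v) :
    spread x mk P v = spread x mk P' v := by
  by_cases hP : P v
  · simp [spread, hP, h.1 hP]
  · simp [spread, hP, mt h.2 hP]

/-- Vertices at distance `d ≤ t` are marked `d + 1`. -/
noncomputable def markOf (H : SimpleGraph ℕ) (X : Set ℕ) (t v : ℕ) : ℕ := by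
  classical exact if v ∈ ball H X t then lev H X v + 1 else 0

theorem markOf_eq_zero {H : SimpleGraph ℕ} {X : Set ℕ} {t v : ℕ} :
    markOf H X t v = 0 ↔ v ∉ ball H X t := by
  simp [markOf]

theorem markOf_zero (H : SimpleGraph ℕ) (X : Set ℕ) (v : ℕ) : markOf H X 0 v = bit (v ∈ X) := by
  by_cases h : v ∈ X
  · have h' : v ∈ ball H X 0 := h
    have := lev_le h'
    simp only [markOf, h', if_true, bit, h]
    omega
  · have h' : v ∉ ball H X 0 := h
    simp [markOf, h', bit, h]

theorem markOf_eq_iff {H : SimpleGraph ℕ} {X : Set ℕ} {t v : ℕ} :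
    markOf H X t v = t + 1 ↔ v ∈ ball H X t ∧ lev H X v = t := by
  by_cases h : v ∈ ball H X t <;> simp [markOf, h]

/-- A vertex that is new in the next ball has a predecessor at distance exactly `t`, so scanning the
last layer suffices. -/
theorem markOf_succ (H : SimpleGraph ℕ) (X : Set ℕ) (t v : ℕ) : markOf H X (t + 1) v =
    spread (t + 2) (markOf H X t) (fun v => ∃ u, markOf H X t u = t + 1 ∧ H.Adj u v) v := by
  by_cases h : v ∈ ball H X t
  · have h' : v ∈ ball H X (t + 1) := ball_mono (Nat.le_succ t) h
    simp [spread, markOf, h, h']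
  · have h0 : markOf H X t v = 0 := by simp [markOf, h]
    by_cases h' : v ∈ ball H X (t + 1)
    · have hl : lev H X v = t + 1 := by
        have h1 := lev_le h'
        have h2 : ¬ lev H X v ≤ t := fun h2 => h (mem_ball_of_lev_le h' h2)
        omega
      obtain ⟨u, huv, hu, hut⟩ := exists_pred ⟨_, h'⟩ hl
      have : ∃ u, markOf H X t u = t + 1 ∧ H.Adj u v := ⟨u, markOf_eq_iff.2 ⟨hu, hut⟩, huv⟩
      rw [spread, if_pos ⟨h0, this⟩]
      simp [markOf, h', hl]
    · have : ¬ ∃ u, markOf H X t u = t + 1 ∧ H.Adj u v := fun ⟨u, hu, huv⟩ =>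
        h' (mem_ball_succ (markOf_eq_iff.1 hu).1 huv)
      rw [spread, if_neg fun h => this h.2, h0, markOf_eq_zero.2 h']

/-- Mark the unmarked neighbours of the vertex whose row starts at `r_11` with `r_23`. -/
def scanRow : Prog :=
  forLoop 30 31 2 (.add 32 11 19 ;; .add 32 32 30 ;; .load 33 32 ;; .add 34 4 30 ;; .load 35 34 ;;
    .cond 33 (.cond 35 .skip (.store 34 23)) .skip)

/-- `P` stands for what has been reached from the rows scanned earlier in the same round. -/
theorem wp_scanRow (hc : Ctx N M s) {u x : ℕ} {P : ℕ → Prop} (hu : u < N)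
    (h11 : s.reg 11 = row N u) (h23 : s.reg 23 = x) (hx : x ≠ 0)
    (hR : Rep N b st tt a (spread x mk P) s.mem) :
    wp M scanRow (fun s' => Rep N b st tt a (spread x mk fun v => P v ∨ a u v) s'.mem) s := by
  refine wp_forLoop
    (fun l s' => Rep N b st tt a (spread x mk fun v => P v ∨ (v < l ∧ a u v)) s'.mem)
    (by decide) (by decide) hc.one (hc.order ▸ hc.le) (fun _ _ _ h => ⟨h, h⟩) ?_ ?_ ?_
  · exact hR.congr (fun _ _ _ _ => Iff.rfl) fun v _ => by simp
  · intro v s' hv hi hf hI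
    rw [hc.order] at hv
    have hc' := hc.frame hf (by decide)
    have e11 := (hf 11 (by decide)).trans h11
    have e23 := (hf 23 (by decide)).trans h23
    have ha := hI.adj u hu v hv
    have hm := hI.mark v hv
    simp only [wp, reg_setReg, mem_setReg, mem_setMem, e11, hc'.three, hi, hc'.marks, e23,
      Nat.reduceEqDiff, if_false, if_true, ha, hm, bit_ne_zero, bit_eq_zero]
    refine ⟨fun hav => ⟨fun h0 => ?_, fun h0 => ?_⟩, fun hav => ?_⟩
    · refine hI.congr (fun _ _ _ _ => Iff.rfl) fun w _ => ?_
      by_cases hwv : w = v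
      · subst hwv
        have : w < w + 1 := by omega
        by_cases h1 : mk w = 0 <;> by_cases h2 : P w <;> simp_all [spread]
      · have : w < v + 1 ↔ w < v := by omega
        exact spread_congr (by rw [this])
    · refine (hI.set_mark hv x).congr (fun _ _ _ _ => Iff.rfl) fun w _ => ?_
      by_cases hwv : w = v
      · subst hwv
        have : w < w + 1 := by omega
        by_cases h1 : mk w = 0 <;> by_cases h2 : P w <;> simp_all [spread]
      · have : w < v + 1 ↔ w < v := by omega
        rw [update_of_ne hwv]
        exact spread_congr (by rw [this])
    · refine hI.congr (fun _ _ _ _ => Iff.rfl) fun w _ => ?_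
      have : (w < v + 1 ∧ a u w) ↔ (w < v ∧ a u w) := by
        constructor
        · rintro ⟨h1, h2⟩
          refine ⟨?_, h2⟩
          rcases Nat.lt_succ_iff_lt_or_eq.1 h1 with h | rfl
          · exact h
          · exact absurd h2 hav
        · rintro ⟨h1, h2⟩; exact ⟨by omega, h2⟩
      exact spread_congr (by rw [this])
  · intro s' hI
    rw [hc.order] at hI
    exact hI.congr (fun _ _ _ _ => Iff.rfl) fun v hv =>
      spread_congr (by simp [hv])

/-- One round of breadth first search. -/
def scanAll : Prog :=
  .add 22 20 1 ;; .add 23 22 1 ;; .copy 11 8 ;;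
  forLoop 24 25 2 (.add 26 4 24 ;; .load 27 26 ;; .sub 28 27 22 ;; .sub 29 22 27 ;; .add 28 28 29 ;;
    (.cond 28 .skip scanRow) ;; .add 11 11 3)

/-- The machine cannot multiply, so the address of the current row is carried along in register `11`
as part of the invariant. -/
theorem wp_scanAll (hc : Ctx N M s) {t : ℕ} (h20 : s.reg 20 = t)
    (hR : Rep N b st tt a mk s.mem) :
    wp M scanAll (fun s' => Rep N b st tt a
      (spread (t + 2) mk fun v => ∃ u < N, mk u = t + 1 ∧ a u v) s'.mem) s := by
  simp only [scanAll, wp]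
  set s₁ := ((s.setReg 22 _).setReg 23 _).setReg 11 _ with hs₁
  have hc₁ : Ctx N M s₁ := hc.frame (l := [22, 23, 11])
    (fun r hr => by simp at hr; simp [hs₁, hr]) (by decide)
  have e22 : s₁.reg 22 = t + 1 := by simp [hs₁, h20, hc.one]
  have e23 : s₁.reg 23 = t + 2 := by simp [hs₁, h20, hc.one]
  have e11 : s₁.reg 11 = row N 0 := by simp [hs₁, hc.header, row]
  refine wp_forLoop (fun u s' => s'.reg 11 = row N u ∧ Rep N b st tt a
      (spread (t + 2) mk fun v => ∃ u' < u, mk u' = t + 1 ∧ a u' v) s'.mem)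
    (by decide) (by decide) hc₁.one (hc₁.order ▸ hc₁.le) (fun _ _ _ h => by simpa using h) ?_ ?_ ?_
  · exact ⟨e11, hR.congr (fun _ _ _ _ => Iff.rfl) fun v _ => by simp [spread]⟩
  · rintro u s' hu hi hf ⟨h11, hI⟩
    rw [hc₁.order] at hu
    have hc' := hc₁.frame hf (by decide)
    have e22 := (hf 22 (by decide)).trans e22
    have e23 := (hf 23 (by decide)).trans e23
    have hm := hI.mark u hu
    simp only [wp, reg_setReg, mem_setReg, hi, hc'.marks, e22, hm, Nat.reduceEqDiff, if_false,
      if_true]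
    -- Marks written in this round are `t + 2`, hence never mistaken for the frontier mark `t + 1`.
    -- The program tests equality by adding the two truncated differences.
    have hiff : (∀ P, spread (t + 2) mk P u = t + 1 ↔ mk u = t + 1) := by
      intro P
      by_cases h0 : mk u = 0 <;> by_cases h1 : P u <;> simp [spread, h0, h1]
    refine ⟨fun h => ?_, fun h => ?_⟩
    · refine ⟨by rw [h11, hc'.width, row_succ], hI.congr (fun _ _ _ _ => Iff.rfl) fun v _ => ?_⟩
      have hne : mk u ≠ t + 1 := fun h' =>
        h (by rw [(hiff fun v => ∃ u' < u, mk u' = t + 1 ∧ a u' v).2 h']; omega)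
      have : (∃ u' < u + 1, mk u' = t + 1 ∧ a u' v) ↔ ∃ u' < u, mk u' = t + 1 ∧ a u' v := by
        refine exists_congr fun u' => ?_
        constructor
        · rintro ⟨h1, h2⟩
          refine ⟨?_, h2⟩
          rcases Nat.lt_succ_iff_lt_or_eq.1 h1 with h | rfl
          · exact h
          · exact absurd h2.1 hne
        · rintro ⟨h1, h2⟩; exact ⟨by omega, h2⟩
      exact spread_congr this.symm
    · have heq : mk u = t + 1 := (hiff fun v => ∃ u' < u, mk u' = t + 1 ∧ a u' v).1 (by omega)
      set s₂ := ((((s'.setReg 26 _).setReg 27 _).setReg 28 _).setReg 29 _).setReg 28 _ with hs₂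
      have hf₂ : Frame [26, 27, 28, 29] s' s₂ := fun r hr => by simp at hr; simp [hs₂, hr]
      have hc₂ : Ctx N M s₂ := hc'.frame hf₂ (by decide)
      refine wp_mono (p := scanRow) (wp_frame (wp_scanRow hc₂ hu ((hf₂ 11 (by decide)).trans h11)
        ((hf₂ 23 (by decide)).trans e23) (by omega) hI)) fun s₃ h₃ => ?_
      obtain ⟨hR₃, hf₃⟩ := h₃
      refine ⟨?_, hR₃.congr (fun _ _ _ _ => Iff.rfl) fun v _ => ?_⟩
      · have h1 := hf₃ 11 (by decide)
        have h2 := hf₃ 3 (by decide)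
        change (s₃.setReg 11 (s₃.reg 11 + s₃.reg 3)).reg 11 = _
        rw [reg_setReg, if_pos rfl, h1, h2, hc₂.width, row_succ, hf₂ 11 (by decide), h11]
      · have : ((∃ u' < u, mk u' = t + 1 ∧ a u' v) ∨ a u v) ↔
            ∃ u' < u + 1, mk u' = t + 1 ∧ a u' v := by
          constructor
          · rintro (⟨u', h1, h2⟩ | h)
            · exact ⟨u', by omega, h2⟩
            · exact ⟨u, by omega, heq, h⟩
          · rintro ⟨u', h1, h2⟩
            rcases Nat.lt_succ_iff_lt_or_eq.1 h1 with h | rfl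
            · exact Or.inl ⟨u', h, h2⟩
            · exact Or.inr h2.2
        exact spread_congr this
  · rintro s' ⟨-, hI⟩
    rwa [hc₁.order] at hI

/-- Breadth first search for `r_6` rounds. -/
def search : Prog := forLoop 20 21 6 scanAll

theorem wp_search {H : SimpleGraph ℕ} {X : Set ℕ} (hH : ∀ u v, H.Adj u v → u < N)
    (hc : Ctx N M s) {R : ℕ} (h6 : s.reg 6 = R) (hRM : R ≤ M)
    (hR : Rep N b st tt H.Adj (markOf H X 0) s.mem) :
    wp M search (fun s' => Rep N b st tt H.Adj (markOf H X R) s'.mem) s := by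
  refine wp_forLoop (fun t s' => Rep N b st tt H.Adj (markOf H X t) s'.mem)
    (by decide) (by decide) hc.one (h6 ▸ hRM) (fun _ _ _ h => ⟨h, h⟩) hR ?_ ?_
  · intro t s' ht hi hf hI
    refine wp_mono (wp_scanAll (hc.frame hf (by decide)) hi hI) fun s'' h'' => ?_
    refine h''.congr (fun _ _ _ _ => Iff.rfl) fun v _ => ?_
    rw [markOf_succ]
    have : ∀ v, (∃ u < N, markOf H X t u = t + 1 ∧ H.Adj u v) ↔
        ∃ u, markOf H X t u = t + 1 ∧ H.Adj u v := fun v =>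
      exists_congr fun u => ⟨fun h => h.2, fun h => ⟨hH _ _ h.2, h⟩⟩
    exact spread_congr (this v)
  · intro s' hI
    rwa [h6] at hI

/-! ### Reading the input -/

/-- Read the unary number at the beginning of the memory into `r_2`. -/
def findOrder : Prog :=
  .const 1 1 ;; .const 2 0 ;; .load 10 2 ;; .loop 10 (.add 2 2 1 ;; .load 10 2)

theorem wp_findOrder (hNM : N ≤ M) (h1 : ∀ i < N, s.mem i ≠ 0) (h0 : s.mem N = 0) :
    wp M findOrder (fun s' => s'.reg 1 = 1 ∧ s'.reg 2 = N ∧ s'.mem = s.mem) s := by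
  refine ⟨fun j s' => s'.reg 1 = 1 ∧ s'.reg 2 + j = N ∧ s'.reg 10 = s.mem (s'.reg 2) ∧
    s'.mem = s.mem, N, hNM, by simp, ?_, ?_⟩
  · rintro j s' ⟨e1, e2, e3, e4⟩
    refine ⟨e3 ▸ h1 _ (by omega), ?_⟩
    simp only [wp, reg_setReg, mem_setReg, Nat.reduceEqDiff, if_false, if_true, e1, e4, true_and,
      and_true]
    omega
  · rintro s' ⟨e1, e2, e3, e4⟩
    obtain rfl : s'.reg 2 = N := by omega
    exact ⟨e3.trans h0, e1, rfl, e4⟩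

/-- Compute the addresses of the parts of the memory. -/
def layout : Prog :=
  .const 19 3 ;; .add 3 2 19 ;; .copy 4 0 ;; .add 5 0 0 ;; .add 8 2 1 ;; .const 6 0

theorem wp_layout (hNM : N ≤ M) (h0 : s.reg 0 = row N N) (h1 : s.reg 1 = 1) (h2 : s.reg 2 = N) :
    wp M layout (fun s' => Ctx N M s' ∧ s'.reg 6 = 0 ∧ s'.mem = s.mem) s := by
  simp only [layout, wp]
  refine ⟨⟨?_, ?_, ?_, ?_, ?_, ?_, ?_, hNM⟩, ?_, rfl⟩ <;> simp [h0, h1, h2, two_mul]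

/-- Mark the terminals, and count the agents. -/
def initMarks : Prog :=
  .copy 11 8 ;;
  forLoop 12 13 2 (.add 14 11 1 ;; .load 15 14 ;; .add 14 14 1 ;; .load 16 14 ;; .add 6 6 15 ;;
    .add 17 4 12 ;; .add 18 15 16 ;; (.cond 18 (.store 17 1) .skip) ;; .add 11 11 3)

theorem wp_initMarks (hc : Ctx N M s) (h6 : s.reg 6 = 0)
    (hR : Rep N b st tt a (fun _ => 0) s.mem) :
    wp M initMarks (fun s' => s'.reg 6 = ∑ v ∈ Finset.range N, bit (v ∈ st) ∧
      Rep N b st tt a (fun v => bit (v ∈ st ∪ tt)) s'.mem) s := by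
  classical
  simp only [initMarks, wp]
  have hc₁ : Ctx N M (s.setReg 11 (s.reg 8)) := hc.frame (frame_setReg _ _ _) (by decide)
  refine wp_forLoop (fun j s' => s'.reg 11 = row N j ∧
      s'.reg 6 = ∑ v ∈ Finset.range j, bit (v ∈ st) ∧
      Rep N b st tt a (fun v => if v < j then bit (v ∈ st ∪ tt) else 0) s'.mem)
    (by decide) (by decide) hc₁.one (hc₁.order ▸ hc₁.le) (fun _ _ _ h => by simpa using h) ?_ ?_ ?_
  · exact ⟨by simp [hc.header, row], by simp [h6], by simpa using hR⟩
  · rintro v s' hv hi hf ⟨h11, h6, hI⟩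
    rw [hc₁.order] at hv
    have hc' := hc₁.frame hf (by decide)
    have hs := hI.start v hv
    have ht := hI.target v hv
    simp only [wp, reg_setReg, mem_setReg, mem_setMem, reg_setMem, h11, hc'.one, hi, hc'.marks,
      hc'.width, Nat.reduceEqDiff, if_false, if_true, hs, ht, add_assoc, Nat.reduceAdd, h6,
      ← row_succ, ← Finset.sum_range_succ, true_and]
    refine ⟨fun h => ?_, fun h => ?_⟩
    · refine (hI.set_mark hv 1).congr (fun _ _ _ _ => Iff.rfl) fun w _ => ?_
      by_cases hwv : w = v
      · subst hwv
        have : w ∈ st ∪ tt := by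
          by_contra hcon
          rw [Set.mem_union, not_or] at hcon
          exact h (by simp [bit, hcon.1, hcon.2])
        rw [update_self, if_pos (by omega), bit_true this]
      · have : w < v + 1 ↔ w < v := by omega
        simp only [update_of_ne hwv, this]
    · refine hI.congr (fun _ _ _ _ => Iff.rfl) fun w _ => ?_
      by_cases hwv : w = v
      · subst hwv
        have h1 : bit (w ∈ st) = 0 := by omega
        have h2 : bit (w ∈ tt) = 0 := by omega
        have : w ∉ st ∪ tt := fun h => h.elim (bit_eq_zero.1 h1) (bit_eq_zero.1 h2)
        rw [if_neg (by omega), if_pos (by omega), bit_eq_zero.2 this]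
      · have : w < v + 1 ↔ w < v := by omega
        simp only [this]
  · rintro s' ⟨-, h6, hI⟩
    simp only [reg_setReg, Nat.reduceEqDiff, if_false, hc.order] at h6 hI
    exact ⟨h6, hI.congr (fun _ _ _ _ => Iff.rfl) fun v hv => by simp [hv]⟩

/-- Compute the radius from the number of agents. -/
def radius : Prog := .add 6 6 6 ;; .add 6 6 6 ;; .const 10 17 ;; .add 6 6 10

theorem wp_radius {n : ℕ} (h6 : s.reg 6 = n) :
    wp M radius (fun s' => s'.reg 6 = 4 * n + 17 ∧ s'.mem = s.mem) s := by
  simp only [radius, wp]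
  refine ⟨?_, rfl⟩
  simp [h6]
  omega

/-! ### Elimination -/

/-- The edges of `E` together with those edges that arise from the elimination of `w` and
satisfy `P`. -/
def fill (E : SimpleGraph ℕ) (w : ℕ) (P : ℕ → ℕ → Prop) (x y : ℕ) : Prop :=
  E.Adj x y ∨ (x ≠ y ∧ P x y ∧ E.Adj x w ∧ E.Adj w y)

/-- Row and column of `w` do not change while `w` is eliminated, so the matrix may be overwritten
while it is being read. -/
theorem fill_left {E : SimpleGraph ℕ} {w v : ℕ} {P : ℕ → ℕ → Prop} :
    fill E w P w v ↔ E.Adj w v := by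
  simp [fill]

theorem fill_right {E : SimpleGraph ℕ} {w u : ℕ} {P : ℕ → ℕ → Prop} :
    fill E w P u w ↔ E.Adj u w := by
  simp [fill]

/-- Make the vertex `r_24` adjacent to the neighbours of the vertex `r_37`. -/
def fillRow : Prog :=
  forLoop 30 31 2 (.add 32 36 19 ;; .add 32 32 30 ;; .load 33 32 ;; .sub 28 24 30 ;;
    .sub 29 30 24 ;; .add 28 28 29 ;;
    .cond 33 (.cond 28 (.add 32 11 19 ;; .add 32 32 30 ;; .store 32 1) .skip) .skip)

theorem wp_fillRow {E : SimpleGraph ℕ} (hc : Ctx N M s) {u w : ℕ} (hu : u < N) (hw : w < N)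
    (h11 : s.reg 11 = row N u) (h24 : s.reg 24 = u) (h36 : s.reg 36 = row N w) (huw : E.Adj u w)
    (hR : Rep N b st tt (fill E w fun x _ => x < u) mk s.mem) :
    wp M fillRow (fun s' => Rep N b st tt (fill E w fun x _ => x < u + 1) mk s'.mem) s := by
  refine wp_forLoop
    (fun v s' => Rep N b st tt (fill E w fun x y => x < u ∨ (x = u ∧ y < v)) mk s'.mem)
    (by decide) (by decide) hc.one (hc.order ▸ hc.le) (fun _ _ _ h => ⟨h, h⟩) ?_ ?_ ?_
  · exact hR.congr (fun _ _ _ _ => by simp [fill]) fun _ _ => rfl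
  · intro v s' hv hi hf hI
    rw [hc.order] at hv
    have hc' := hc.frame hf (by decide)
    have e11 := (hf 11 (by decide)).trans h11
    have e24 := (hf 24 (by decide)).trans h24
    have e36 := (hf 36 (by decide)).trans h36
    have ha := hI.adj w hw v hv
    simp only [wp, reg_setReg, mem_setReg, mem_setMem, e11, e24, e36, hc'.three, hc'.one, hi,
      Nat.reduceEqDiff, if_false, if_true, ha, bit_ne_zero, bit_eq_zero, fill_left]
    refine ⟨fun hwv => ⟨fun huv => ?_, fun huv => ?_⟩, fun hwv => ?_⟩
    · refine (hI.set_adj hu hv).congr (fun x _ y _ => ?_) fun _ _ => rfl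
      constructor
      · rintro ((h | ⟨h1, h2, h3, h4⟩) | ⟨rfl, rfl⟩)
        · exact Or.inl h
        · exact Or.inr ⟨h1, by omega, h3, h4⟩
        · exact Or.inr ⟨by omega, by omega, huw, hwv⟩
      · rintro (h | ⟨h1, h2, h3, h4⟩)
        · exact Or.inl (Or.inl h)
        · by_cases h : x = u ∧ y = v
          · exact Or.inr h
          · exact Or.inl (Or.inr ⟨h1, by omega, h3, h4⟩)
    · refine hI.congr (fun x _ y _ => ?_) fun _ _ => rfl
      refine or_congr_right (and_congr_right fun hxy => and_congr_left fun _ => ?_)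
      omega
    · refine hI.congr (fun x _ y _ => ?_) fun _ _ => rfl
      refine or_congr_right (and_congr_right fun hxy => and_congr_left fun h => ?_)
      have : y ≠ v := fun e => hwv (e ▸ h.2)
      omega
  · intro s' hI
    rw [hc.order] at hI
    refine hI.congr (fun x _ y hy => ?_) fun _ _ => rfl
    refine or_congr_right (and_congr_right fun hxy => and_congr_left fun _ => ?_)
    omega

/-- Eliminate the vertex `r_37`. -/
def fillAll : Prog :=
  .copy 11 8 ;;
  forLoop 24 25 2 (.add 26 11 19 ;; .add 26 26 37 ;; .load 27 26 ;; (.cond 27 fillRow .skip) ;;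
    .add 11 11 3)

theorem wp_fillAll {E : SimpleGraph ℕ} (hc : Ctx N M s) {w : ℕ} (hw : w < N)
    (h36 : s.reg 36 = row N w) (h37 : s.reg 37 = w) (hR : Rep N b st tt E.Adj mk s.mem) :
    wp M fillAll (fun s' => Rep N b st tt (elim E w).Adj mk s'.mem) s := by
  simp only [fillAll, wp]
  have hc₁ : Ctx N M (s.setReg 11 (s.reg 8)) := hc.frame (frame_setReg _ _ _) (by decide)
  refine wp_forLoop (fun u s' => s'.reg 11 = row N u ∧
      Rep N b st tt (fill E w fun x _ => x < u) mk s'.mem)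
    (by decide) (by decide) hc₁.one (hc₁.order ▸ hc₁.le) (fun _ _ _ h => by simpa using h) ?_ ?_ ?_
  · exact ⟨by simp [hc.header, row], hR.congr (fun _ _ _ _ => by simp [fill]) fun _ _ => rfl⟩
  · rintro u s' hu hi hf ⟨h11, hI⟩
    rw [hc₁.order] at hu
    have hc' := hc₁.frame hf (by decide)
    have e36 : s'.reg 36 = row N w := (hf 36 (by decide)).trans (by simpa using h36)
    have e37 : s'.reg 37 = w := (hf 37 (by decide)).trans (by simpa using h37)
    have ha := hI.adj u hu w hw
    simp only [wp, reg_setReg, mem_setReg, h11, e37, hc'.three, Nat.reduceEqDiff, if_false,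
      if_true, ha, bit_ne_zero, bit_eq_zero, fill_right]
    refine ⟨fun huw => ?_, fun huw => ?_⟩
    · set s₂ := ((s'.setReg 26 _).setReg 26 _).setReg 27 _ with hs₂
      have hf₂ : Frame [26, 27] s' s₂ := fun r hr => by simp at hr; simp [hs₂, hr]
      have hc₂ : Ctx N M s₂ := hc'.frame hf₂ (by decide)
      refine wp_mono (p := fillRow) (wp_frame (wp_fillRow hc₂ hu hw
        ((hf₂ 11 (by decide)).trans h11) ((hf₂ 24 (by decide)).trans hi)
        ((hf₂ 36 (by decide)).trans e36) huw hI)) fun s₃ h₃ => ?_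
      obtain ⟨hR₃, hf₃⟩ := h₃
      refine ⟨?_, hR₃⟩
      have h1 := hf₃ 11 (by decide)
      have h2 := hf₃ 3 (by decide)
      change (s₃.setReg 11 (s₃.reg 11 + s₃.reg 3)).reg 11 = _
      rw [reg_setReg, if_pos rfl, h1, h2, hc₂.width, row_succ, hf₂ 11 (by decide), h11]
    · refine ⟨by rw [hc'.width, row_succ], hI.congr (fun x _ y _ => ?_) fun _ _ => rfl⟩
      refine or_congr_right (and_congr_right fun hxy => and_congr_left fun h => ?_)
      have : x ≠ u := fun e => huw (e ▸ h.1)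
      omega
  · rintro s' ⟨-, hI⟩
    simp only [reg_setReg, Nat.reduceEqDiff, if_false, hc.order] at hI
    exact hI.congr (fun x hx y _ => by simp [fill, elim, hx]) fun _ _ => rfl

/-- Eliminate all unmarked vertices. -/
def eliminate : Prog :=
  .copy 36 8 ;;
  forLoop 37 38 2 (.add 39 4 37 ;; .load 40 39 ;; (.cond 40 .skip fillAll) ;; .add 36 36 3)

theorem wp_eliminate {H : SimpleGraph ℕ} {W : Set ℕ} (hc : Ctx N M s)
    (hW : ∀ v < N, mk v = 0 ↔ v ∈ W) (hR : Rep N b st tt H.Adj mk s.mem) :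
    wp M eliminate (fun s' => Rep N b st tt (elimUpTo H W N).Adj mk s'.mem) s := by
  simp only [eliminate, wp]
  have hc₁ : Ctx N M (s.setReg 36 (s.reg 8)) := hc.frame (frame_setReg _ _ _) (by decide)
  refine wp_forLoop (fun w s' => s'.reg 36 = row N w ∧
      Rep N b st tt (elimUpTo H W w).Adj mk s'.mem)
    (by decide) (by decide) hc₁.one (hc₁.order ▸ hc₁.le) (fun _ _ _ h => by simpa using h) ?_ ?_ ?_
  · exact ⟨by simp [hc.header, row], hR⟩
  · rintro w s' hw hi hf ⟨h36, hI⟩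
    rw [hc₁.order] at hw
    have hc' := hc₁.frame hf (by decide)
    have hm := hI.mark w hw
    simp only [wp, reg_setReg, mem_setReg, hc'.marks, hi, hm, Nat.reduceEqDiff, if_false,
      if_true]
    refine ⟨fun h => ?_, fun h => ?_⟩
    · have : w ∉ W := fun h' => h ((hW w hw).2 h')
      refine ⟨by rw [h36, hc'.width, row_succ], ?_⟩
      simpa only [elimUpTo, this, if_false] using hI
    · have : w ∈ W := (hW w hw).1 h
      set s₂ := (s'.setReg 39 _).setReg 40 _ with hs₂
      have hf₂ : Frame [39, 40] s' s₂ := fun r hr => by simp at hr; simp [hs₂, hr]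
      have hc₂ : Ctx N M s₂ := hc'.frame hf₂ (by decide)
      refine wp_mono (p := fillAll) (wp_frame (wp_fillAll hc₂ hw
        ((hf₂ 36 (by decide)).trans h36) ((hf₂ 37 (by decide)).trans hi) hI)) fun s₃ h₃ => ?_
      obtain ⟨hR₃, hf₃⟩ := h₃
      have h1 := hf₃ 36 (by decide)
      have h2 := hf₃ 3 (by decide)
      refine ⟨?_, by simpa only [elimUpTo, this, if_true] using hR₃⟩
      change (s₃.setReg 36 (s₃.reg 36 + s₃.reg 3)).reg 36 = _
      rw [reg_setReg, if_pos rfl, h1, h2, hc₂.width, row_succ, hf₂ 36 (by decide), h36]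
  · rintro s' ⟨-, hI⟩
    simpa only [reg_setReg, Nat.reduceEqDiff, if_false, hc.order] using hI

/-! ### Writing the output -/

/-- The bits `pre` have been written to the output region, and `ptr` is the next free cell. -/
structure Out (N : ℕ) (pre : List Bool) (ptr : ℕ) (m : ℕ → ℕ) : Prop where
  ptr_eq : ptr = 2 * row N N + pre.length
  bits : ∀ i < pre.length, m (2 * row N N + i) = (pre.getD i false).toNat

open Classical in
theorem Out.push {pre : List Bool} {ptr : ℕ} (h : Out N pre ptr m) (p : Prop) :
    Out N (pre ++ [decide p]) (ptr + 1) (update m ptr (bit p)) := by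
  refine ⟨by simp [h.ptr_eq, add_assoc], fun i hi => ?_⟩
  rw [List.length_append, List.length_singleton] at hi
  rcases Nat.lt_succ_iff_lt_or_eq.1 hi with hi | rfl
  · rw [update_of_ne (by have := h.ptr_eq; omega), h.bits i hi, List.getD_append _ _ _ _ hi]
  · rw [h.ptr_eq, update_self, List.getD_append_right _ _ _ _ le_rfl]
    simp [bit_decide]

/-- The marked vertices below `j`. -/
def keptTo (mk : ℕ → ℕ) (j : ℕ) : List ℕ := (List.range j).filter fun v => decide (mk v ≠ 0)

theorem keptTo_succ (mk : ℕ → ℕ) (j : ℕ) :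
    keptTo mk (j + 1) = keptTo mk j ++ if mk j ≠ 0 then [j] else [] := by
  rw [keptTo, List.range_succ, List.filter_append, keptTo]
  by_cases h : mk j = 0 <;> simp [h]

/-- The graph is stored in the memory, and the bits `pre` have been written. -/
def Wr (N : ℕ) (b s t : Set ℕ) (a : ℕ → ℕ → Prop) (mk : ℕ → ℕ) (pre : List Bool) (σ : State) :
    Prop :=
  Rep N b s t a mk σ.mem ∧ Out N pre (σ.reg 7) σ.mem

variable {pre : List Bool}

open Classical in
theorem Wr.push (h : Wr N b st tt a mk pre s) {p : Prop} (h7 : s'.reg 7 = s.reg 7 + 1)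
    (hm : s'.mem = update s.mem (s.reg 7) (bit p)) :
    Wr N b st tt a mk (pre ++ [decide p]) s' := by
  refine ⟨?_, ?_⟩
  · rw [hm]
    exact h.1.set_high (by rw [h.2.ptr_eq]; omega) _
  · rw [h7, hm]
    exact h.2.push p

theorem Wr.of_eq (h : Wr N b st tt a mk pre s) (h7 : s'.reg 7 = s.reg 7) (hm : s'.mem = s.mem) :
    Wr N b st tt a mk pre s' := by
  rw [Wr, h7, hm]
  exact h

/-- Write the bit at the address `r_26`. -/
def emit : Prog := .load 28 26 ;; .store 7 28 ;; .add 7 7 1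

open Classical in
theorem wp_emit (h1 : s.reg 1 = 1) {p : Prop} (h : Wr N b st tt a mk pre s)
    (hp : s.mem (s.reg 26) = bit p) :
    wp M emit (Wr N b st tt a mk (pre ++ [decide p])) s := by
  simp only [emit, wp]
  exact h.push (by simp [h1]) (by simp [hp])

/-- Write the number of marked vertices in unary. -/
def writeOrder : Prog :=
  forLoop 12 13 2 (.add 14 4 12 ;; .load 15 14 ;; .cond 15 (.store 7 1 ;; .add 7 7 1) .skip)

theorem wp_writeOrder (hc : Ctx N M s) (h : Wr N b st tt a mk [] s) :
    wp M writeOrder (Wr N b st tt a mk (List.replicate (keptTo mk N).length true)) s := by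
  classical
  refine wp_forLoop (fun j s' => Wr N b st tt a mk (List.replicate (keptTo mk j).length true) s')
    (by decide) (by decide) hc.one (hc.order ▸ hc.le)
    (fun _ _ _ h => ⟨h.of_eq (by simp) rfl, h.of_eq (by simp) rfl⟩) ?_ ?_ ?_
  · simpa [keptTo] using h
  · intro v s' hv hi hf hI
    rw [hc.order] at hv
    have hc' := hc.frame hf (by decide)
    have hm := hI.1.mark v hv
    rw [keptTo_succ]
    simp only [wp, reg_setReg, mem_setReg, hc'.marks, hi, hm, Nat.reduceEqDiff, if_false,
      if_true]
    refine ⟨fun h => ?_, fun h => ?_⟩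
    · rw [if_pos h, List.length_append, List.length_singleton, List.replicate_succ']
      have := hI.push (p := True) (s' := (((s'.setReg 14 (row N N + v)).setReg 15 (mk v)).setMem
        (s'.reg 7) (s'.reg 1)).setReg 7 (s'.reg 7 + s'.reg 1)) (by simp [hc'.one])
        (by simp [hc'.one, bit])
      simpa using this
    · rw [if_neg (by simpa using h), List.append_nil]
      exact hI.of_eq (by simp) rfl
  · intro s' hI
    rwa [hc.order] at hI

/-- Write the three flags of the vertex whose row starts at `r_11` and whose mark is `r_27`. -/
def writeFlags : Prog :=
  (.add 29 6 1 ;; .sub 29 29 27 ;; .cond 29 (.copy 26 11 ;; emit) (.store 7 1 ;; .add 7 7 1)) ;;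
  (.add 26 11 1 ;; emit) ;; .add 26 26 1 ;; emit

-- The truncated difference `R + 1 - mk v` vanishes exactly if the mark is at least `R + 1`. In the
-- application this singles out the outermost layer, which becomes black; all other kept vertices
-- copy their flag.
open Classical in
theorem wp_writeFlags (hc : Ctx N M s) {v R : ℕ} {b' : Set ℕ} (hv : v < N)
    (hb' : v ∈ b' ↔ v ∈ b ∨ R + 1 ≤ mk v) (h6 : s.reg 6 = R) (h11 : s.reg 11 = row N v)
    (h27 : s.reg 27 = mk v) (h : Wr N b st tt a mk pre s) :
    wp M writeFlags (Wr N b st tt a mk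
      (pre ++ [decide (v ∈ b'), decide (v ∈ st), decide (v ∈ tt)])) s := by
  refine wp_seq (R := Wr N b st tt a mk (pre ++ [decide (v ∈ b')])) ?_ fun s₁ h₁ hf₁ => ?_
  · simp only [wp, reg_setReg, Nat.reduceEqDiff, if_false, if_true, h6, hc.one, h27]
    refine ⟨fun h0 => ?_, fun h0 => ?_⟩
    · refine wp_emit (by simp [hc.one]) (h.of_eq (by simp) rfl) ?_
      have : v ∈ b' ↔ v ∈ b := by rw [hb']; exact or_iff_left (by omega)
      simp [h11, h.1.black v hv, this]
    · refine h.push (by simp [hc.one]) ?_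
      simp [hc.one, bit_true (hb'.2 (Or.inr (by omega : R + 1 ≤ mk v)))]
  have hc₁ := hc.frame hf₁ (by decide)
  have e11 : s₁.reg 11 = row N v := (hf₁ 11 (by decide)).trans h11
  refine wp_seq (R := fun s' => Wr N b st tt a mk (pre ++ [decide (v ∈ b'), decide (v ∈ st)]) s' ∧
    s'.reg 26 = row N v + 1) ?_ fun s₂ h₂ hf₂ => ?_
  · refine wp_seq (R := fun s' => Wr N b st tt a mk (pre ++ [decide (v ∈ b')]) s' ∧
      s'.reg 26 = row N v + 1) ⟨h₁.of_eq (by simp) rfl, by simp [e11, hc₁.one]⟩ fun s' h' hf' => ?_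
    refine wp_mono (wp_frame (wp_emit (p := v ∈ st) ((hf' 1 (by decide)).trans hc₁.one) h'.1
      (by rw [h'.2]; exact h'.1.1.start v hv))) fun s'' h'' => ⟨by simpa using h''.1, ?_⟩
    rw [h''.2 26 (by decide), h'.2]
  have e1 : s₂.reg 1 = 1 := (hf₂ 1 (by decide)).trans hc₁.one
  have := wp_emit (M := M) (p := v ∈ tt) (s := s₂.setReg 26 (s₂.reg 26 + s₂.reg 1)) (by simpa using e1)
    (h₂.1.of_eq (by simp) rfl) (by simpa [h₂.2, e1] using h₂.1.1.target v hv)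
  exact wp_mono (p := emit) this fun s' h' => by simpa using h'

/-- Write the adjacencies of the vertex whose row starts at `r_11`. -/
def writeAdj : Prog :=
  forLoop 30 31 2 (.add 34 4 30 ;; .load 35 34 ;;
    .cond 35 (.add 26 11 19 ;; .add 26 26 30 ;; emit) .skip)

open Classical in
theorem wp_writeAdj (hc : Ctx N M s) {v : ℕ} (hv : v < N) (h11 : s.reg 11 = row N v)
    (h : Wr N b st tt a mk pre s) :
    wp M writeAdj (Wr N b st tt a mk (pre ++ (keptTo mk N).map fun u => decide (a v u))) s := by
  refine wp_forLoop
    (fun j s' => Wr N b st tt a mk (pre ++ (keptTo mk j).map fun u => decide (a v u)) s')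
    (by decide) (by decide) hc.one (hc.order ▸ hc.le)
    (fun _ _ _ h => ⟨h.of_eq (by simp) rfl, h.of_eq (by simp) rfl⟩) ?_ ?_ ?_
  · simpa [keptTo] using h
  · intro u s' hu hi hf hI
    rw [hc.order] at hu
    have hc' := hc.frame hf (by decide)
    have e11 := (hf 11 (by decide)).trans h11
    have hm := hI.1.mark u hu
    rw [keptTo_succ]
    simp only [wp, reg_setReg, mem_setReg, hc'.marks, hi, hm, e11, hc'.three, Nat.reduceEqDiff,
      if_false, if_true]
    refine ⟨fun h => ?_, fun h => ?_⟩
    · rw [if_pos h, List.map_append, ← List.append_assoc]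
      exact wp_emit (by simpa using hc'.one) (hI.of_eq (by simp) rfl)
        (by simpa using hI.1.adj v hv u hu)
    · rw [if_neg (by simpa using h), List.append_nil]
      exact hI.of_eq (by simp) rfl
  · intro s' hI
    rwa [hc.order] at hI

/-- Write the rows of all marked vertices. -/
def writeRows : Prog :=
  .copy 11 8 ;;
  forLoop 24 25 2 (.add 26 4 24 ;; .load 27 26 ;; (.cond 27 (writeFlags ;; writeAdj) .skip) ;;
    .add 11 11 3)

open Classical in
theorem wp_writeRows (hc : Ctx N M s) {R : ℕ} {b' : Set ℕ}
    (hb' : ∀ v < N, mk v ≠ 0 → (v ∈ b' ↔ v ∈ b ∨ R + 1 ≤ mk v)) (h6 : s.reg 6 = R)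
    (h : Wr N b st tt a mk pre s) :
    wp M writeRows (Wr N b st tt a mk (pre ++ (keptTo mk N).flatMap fun v =>
      [decide (v ∈ b'), decide (v ∈ st), decide (v ∈ tt)] ++
        (keptTo mk N).map fun u => decide (a v u))) s := by
  simp only [writeRows, wp]
  have hc₁ : Ctx N M (s.setReg 11 (s.reg 8)) := hc.frame (frame_setReg _ _ _) (by decide)
  refine wp_forLoop (fun j s' => s'.reg 11 = row N j ∧
      Wr N b st tt a mk (pre ++ (keptTo mk j).flatMap fun v =>
      [decide (v ∈ b'), decide (v ∈ st), decide (v ∈ tt)] ++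
        (keptTo mk N).map fun u => decide (a v u)) s')
    (by decide) (by decide) hc₁.one (hc₁.order ▸ hc₁.le)
    (fun _ _ _ h => ⟨⟨by simpa using h.1, h.2.of_eq (by simp) rfl⟩,
      ⟨by simpa using h.1, h.2.of_eq (by simp) rfl⟩⟩) ?_ ?_ ?_
  · refine ⟨by simp [hc.header, row], ?_⟩
    rw [show keptTo mk 0 = [] from rfl, List.flatMap_nil, List.append_nil]
    exact h.of_eq (by simp) rfl
  · rintro v s' hv hi hf ⟨h11, hI⟩
    rw [hc₁.order] at hv
    have hc' := hc₁.frame hf (by decide)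
    have hm := hI.1.mark v hv
    rw [keptTo_succ]
    simp only [wp, reg_setReg, mem_setReg, hc'.marks, hi, hm, Nat.reduceEqDiff, if_false, if_true]
    refine ⟨fun h => ?_, fun h => ?_⟩
    · set s₂ := (s'.setReg 26 _).setReg 27 _ with hs₂
      have hf₂ : Frame [26, 27] s' s₂ := fun r hr => by simp at hr; simp [hs₂, hr]
      have hc₂ : Ctx N M s₂ := hc'.frame hf₂ (by decide)
      have e6 : s₂.reg 6 = R := by
        rw [hf₂ 6 (by decide), hf 6 (by decide)]
        simpa using h6
      have e11 : s₂.reg 11 = row N v := (hf₂ 11 (by decide)).trans h11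
      have hI₂ := hI.of_eq (hf₂ 7 (by decide)) (s' := s₂) rfl
      have key : wp M (writeFlags ;; writeAdj) _ s₂ := wp_seq
        (wp_writeFlags hc₂ hv (hb' v hv h) e6 e11 (by simp [hs₂]) hI₂) fun s₃ h₃ hf₃ =>
          wp_writeAdj (hc₂.frame hf₃ (by decide)) hv ((hf₃ 11 (by decide)).trans e11) h₃
      refine wp_mono (p := writeFlags ;; writeAdj) (wp_frame key) fun s₃ h₃ => ?_
      obtain ⟨hW, hf₃⟩ := h₃
      have h1 := hf₃ 11 (by decide)
      have h2 := hf₃ 3 (by decide)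
      refine ⟨?_, ?_⟩
      · change (s₃.setReg 11 (s₃.reg 11 + s₃.reg 3)).reg 11 = _
        rw [reg_setReg, if_pos rfl, h1, h2, hc₂.width, row_succ, e11]
      · refine Wr.of_eq (s := s₃) ?_ (by simp) rfl
        rw [if_pos h, List.flatMap_append, List.flatMap_singleton]
        simpa only [List.append_assoc] using hW
    · refine ⟨by simp [h11, hc'.width, row_succ], ?_⟩
      rw [if_neg (by simpa using h), List.append_nil]
      exact hI.of_eq (by simp) rfl
  · rintro s' ⟨-, hI⟩
    simpa only [reg_setReg, Nat.reduceEqDiff, if_false, hc.order] using hI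

/-- Move the output to the beginning of the memory. -/
def moveDown : Prog :=
  .sub 0 7 5 ;; forLoop 10 12 0 (.add 11 5 10 ;; .load 13 11 ;; .store 10 13)

theorem wp_moveDown (hc : Ctx N M s) (h : Out N pre (s.reg 7) s.mem) (hM : pre.length ≤ M) :
    wp M moveDown (fun s' => s'.Presents pre) s := by
  simp only [moveDown, wp]
  have hc₁ : Ctx N M (s.setReg 0 (s.reg 7 - s.reg 5)) :=
    hc.frame (frame_setReg _ _ _) (by decide)
  have e0 : (s.setReg 0 (s.reg 7 - s.reg 5)).reg 0 = pre.length := by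
    simp [h.ptr_eq, hc.out]
  refine wp_forLoop (fun j s' => s'.reg 0 = pre.length ∧
      (∀ i < pre.length, i < j → s'.mem i = (pre.getD i false).toNat) ∧
      ∀ i < pre.length, j ≤ i → s'.mem (2 * row N N + i) = (pre.getD i false).toNat)
    (by decide) (by decide) hc₁.one (e0 ▸ hM) (fun _ _ _ h => by simpa using h) ?_ ?_ ?_
  · exact ⟨e0, fun i _ hi => by omega, fun i hi _ => h.bits i hi⟩
  · rintro j s' hj hi hf ⟨h0, h1, h2⟩
    rw [e0] at hj
    have hc' := hc₁.frame hf (by decide)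
    simp only [wp, reg_setReg, mem_setReg, mem_setMem, reg_setMem, hi, hc'.out, Nat.reduceEqDiff,
      if_false, if_true, h2 j hj le_rfl, h0, true_and]
    refine ⟨fun i hi hij => ?_, fun i hi hij => ?_⟩
    · rcases Nat.lt_succ_iff_lt_or_eq.1 hij with hij | rfl
      · rw [update_of_ne (by omega), h1 i hi hij]
      · simp
    -- Copying in increasing order is safe even if the regions overlap: the cell written lies below
    -- every source cell that is still to be read.
    · rw [update_of_ne (by omega), h2 i hi (by omega)]
  · rintro s' ⟨h0, h1, -⟩
    rw [e0] at h1
    exact ⟨h0, fun i hi => h1 i hi hi⟩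

/-! ### The whole program -/

theorem getD_flatMap_range (f : ℕ → List Bool) {k : ℕ} (hf : ∀ v, (f v).length = k) (n : ℕ)
    {v c : ℕ} (hv : v < n) (hc : c < k) :
    ((List.range n).flatMap f).getD (v * k + c) false = (f v).getD c false := by
  induction n with
  | zero => omega
  | succ n ih =>
    have hl : ((List.range n).flatMap f).length = n * k := by
      simp [List.length_flatMap, hf]
    rw [List.range_succ, List.flatMap_append, List.flatMap_singleton]
    rcases Nat.lt_succ_iff_lt_or_eq.1 hv with hv | rfl
    · rw [List.getD_append _ _ _ _ ?_, ih hv]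
      have := Nat.mul_le_mul_right k (show v + 1 ≤ n from hv)
      rw [Nat.add_one_mul] at this
      omega
    · rw [List.getD_append_right _ _ _ _ (by omega), hl, Nat.add_sub_cancel_left]

/-! ### Locating the bits of the input word -/

section Input

variable (N : ℕ) (b s t : Set ℕ) (H : SimpleGraph ℕ)

theorem encList_getD_lt {i : ℕ} (hi : i < N) :
    (encList (List.range N) b s t H).getD i false = true := by
  rw [encList, List.append_assoc, List.getD_append _ _ _ _ (by simpa using hi)]
  simp [List.getD_eq_getElem?_getD, hi]

theorem encList_getD_eq : (encList (List.range N) b s t H).getD N false = false := by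
  rw [encList, List.append_assoc, List.getD_append_right _ _ _ _ (by simp)]
  simp

open Classical in
theorem encList_getD_row {v c : ℕ} (hv : v < N) (hc : c < N + 3) :
    (encList (List.range N) b s t H).getD (row N v + c) false =
      ([decide (v ∈ b), decide (v ∈ s), decide (v ∈ t)] ++
        (List.range N).map fun u => decide (H.Adj v u)).getD c false := by
  rw [encList, List.getD_append_right _ _ _ _ (by simp [row]; omega)]
  rw [← getD_flatMap_range (fun v => [decide (v ∈ b), decide (v ∈ s), decide (v ∈ t)] ++
    (List.range N).map fun u => decide (H.Adj v u)) (k := N + 3) (fun v => by simp) N hv hc]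
  congr 1
  simp [row]
  omega

theorem initial_rep : Rep N b s t H.Adj (fun _ => 0)
    (initial (encList (List.range N) b s t H)).mem := by
  classical
  have key : ∀ v < N, ∀ c < N + 3, (initial (encList (List.range N) b s t H)).mem (row N v + c) =
      (([decide (v ∈ b), decide (v ∈ s), decide (v ∈ t)] ++
        (List.range N).map fun u => decide (H.Adj v u)).getD c false).toNat := fun v hv c hc =>
    congrArg Bool.toNat (encList_getD_row N b s t H hv hc)
  refine ⟨fun v hv => ?_, fun v hv => ?_, fun v hv => ?_, fun u hu v hv => ?_, fun v hv => ?_⟩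
  · exact (key v hv 0 (by omega)).trans (by simp [bit_decide])
  · exact (key v hv 1 (by omega)).trans (by simp [bit_decide])
  · exact (key v hv 2 (by omega)).trans (by simp [bit_decide])
  · rw [add_assoc, key u hu (3 + v) (by omega),
      List.getD_append_right _ _ _ _ (by simp)]
    simp [List.getD_eq_getElem?_getD, hv, bit_decide]
  -- The marks lie behind the end of the input, where the memory is initially zero.
  · change Bool.toNat _ = 0
    rw [List.getD_eq_default _ _ (by rw [length_encList, List.length_range, row]; omega)]
    rfl

end Input

/-- Write the bit that follows the unary number. -/
def writeZero : Prog := .const 10 0 ;; .store 7 10 ;; .add 7 7 1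

theorem wp_writeZero {N M : ℕ} {b st tt : Set ℕ} {a : ℕ → ℕ → Prop} {mk : ℕ → ℕ} {s : State}
    {pre : List Bool} (h1 : s.reg 1 = 1) (h : Wr N b st tt a mk pre s) :
    wp M writeZero (Wr N b st tt a mk (pre ++ [false])) s := by
  classical
  simp only [writeZero, wp]
  simpa using h.push (p := False) (s' := ((s.setReg 10 0).setMem (s.reg 7) 0).setReg 7
    (s.reg 7 + s.reg 1)) (by simp [h1]) (by simp [bit])

/-- The kernelization algorithm. -/
def kernelProg : Prog :=
  findOrder ;; layout ;; initMarks ;; radius ;; search ;; eliminate ;; .copy 7 5 ;; writeOrder ;;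
  writeZero ;; writeRows ;; moveDown

variable (I : GMAPFInstance)

theorem sum_bit_eq_agents :
    ∑ v ∈ Finset.range I.order, bit (v ∈ natSet (I.S : Set (Fin I.order))) = I.agents := by
  classical
  rw [Finset.sum_range, GMAPFInstance.agents]
  simp only [mem_natSet, bit, Finset.mem_coe]
  simp

theorem agents_le : I.agents ≤ I.order := by
  simpa [GMAPFInstance.agents] using I.S.card_le_univ

theorem length_encode : I.encode.length = row I.order I.order := by
  rw [encode_eq, length_encList, List.length_range, row]

theorem keptTo_eq :
    keptTo (markOf (natGraph I) (terminals I) (4 * I.agents + 17)) I.order = kept I := by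
  refine List.filter_congr fun v _ => ?_
  rw [decide_eq_decide, Ne, markOf_eq_zero, not_not, near]

theorem length_kept_le : (kept I).length ≤ I.order :=
  (List.length_filter_le _ _).trans_eq (List.length_range ..)

theorem length_encode_kernel_le : (kernel I).encode.length ≤ row I.order I.order := by
  rw [encode_kernel, length_encList, row]
  have := length_kept_le I
  gcongr

/-- Marks are distances plus one, so a marked vertex lies outside the inner ball exactly if its mark
is at least `4 * n + 18`. -/
theorem mem_newBlack_iff {v : ℕ}
    (hv : markOf (natGraph I) (terminals I) (4 * I.agents + 17) v ≠ 0) :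
    v ∈ newBlack I ↔ v ∈ natSet I.galaxy.blackHoles ∨
      4 * I.agents + 17 + 1 ≤ markOf (natGraph I) (terminals I) (4 * I.agents + 17) v := by
  rw [Ne, markOf_eq_zero, not_not] at hv
  refine or_congr_right ?_
  rw [Set.mem_compl_iff, inner]
  simp only [markOf, hv, if_true]
  constructor
  · intro h
    by_contra hcon
    exact h (mem_ball_of_lev_le hv (by omega))
  · intro h h'
    have := lev_le h'
    omega

theorem wp_kernelProg : wp (4 * row I.order I.order + 17) kernelProg
    (fun s' => s'.Presents (kernel I).encode) (initial I.encode) := by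
  classical
  -- One bound for all loops: those over the vertices, the `4 * n + 17` rounds of the search, and
  -- the copying of the output, which is no longer than the input.
  set M := 4 * row I.order I.order + 17 with hM
  set N := I.order with hN
  have hNrow := lt_row N N
  have hNM : N ≤ M := by omega
  have hag := agents_le I
  set w := encList (List.range N) (natSet I.galaxy.blackHoles)
    (natSet (I.S : Set (Fin I.order))) (natSet (I.T : Set (Fin I.order))) (natGraph I) with hw
  have hwI : I.encode = w := encode_eq I
  have hlen : w.length = row N N := by rw [← hwI, length_encode]
  rw [hwI]
  refine wp_seq (wp_findOrder hNM (fun i hi => ?_) ?_) fun s₁ h₁ f₁ => ?_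
  · change Bool.toNat _ ≠ 0
    rw [hw, encList_getD_lt _ _ _ _ _ hi]
    decide
  · change Bool.toNat _ = 0
    rw [hw, encList_getD_eq]
    rfl
  obtain ⟨e1, e2, em⟩ := h₁
  refine wp_seq (wp_layout hNM ((f₁ 0 (by decide)).trans ?_) e1 e2) fun s₂ h₂ f₂ => ?_
  · simp [initial, hlen]
  obtain ⟨c₂, e6, em₂⟩ := h₂
  have hrep := initial_rep N (natSet I.galaxy.blackHoles)
    (natSet (I.S : Set (Fin I.order))) (natSet (I.T : Set (Fin I.order))) (natGraph I)
  rw [← hw, ← em, ← em₂] at hrep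
  refine wp_seq (wp_initMarks c₂ e6 hrep) fun s₃ h₃ f₃ => ?_
  have c₃ := c₂.frame f₃ (by decide)
  obtain ⟨e6, h₃⟩ := h₃
  rw [sum_bit_eq_agents] at e6
  refine wp_seq (wp_radius e6) fun s₄ h₄ f₄ => ?_
  have c₄ := c₃.frame f₄ (by decide)
  obtain ⟨e6, em₄⟩ := h₄
  rw [← em₄] at h₃
  refine wp_seq (wp_search (H := natGraph I) (X := terminals I) natGraph_lt c₄ e6 (by omega)
    (h₃.congr (fun _ _ _ _ => Iff.rfl) fun v _ => (markOf_zero _ _ v).symm)) fun s₅ h₅ f₅ => ?_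
  have c₅ := c₄.frame f₅ (by decide)
  have e6 := (f₅ 6 (by decide)).trans e6
  refine wp_seq (wp_eliminate (W := (near I)ᶜ) c₅ (fun v _ => markOf_eq_zero) h₅)
    fun s₆ h₆ f₆ => ?_
  have c₆ := c₅.frame f₆ (by decide)
  have e6 := (f₆ 6 (by decide)).trans e6
  refine wp_seq (p := .copy 7 5) (R := Wr _ _ _ _ _ _ []) ⟨h₆, by simp [c₆.out], by simp⟩
    fun s₇ h₇ f₇ => ?_
  have c₇ := c₆.frame f₇ (by decide)
  have e6 := (f₇ 6 (by decide)).trans e6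
  refine wp_seq (wp_writeOrder c₇ h₇) fun s₈ h₈ f₈ => ?_
  have c₈ := c₇.frame f₈ (by decide)
  have e6 := (f₈ 6 (by decide)).trans e6
  refine wp_seq (wp_writeZero c₈.one h₈) fun s₉ h₉ f₉ => ?_
  have c₉ := c₈.frame f₉ (by decide)
  have e6 := (f₉ 6 (by decide)).trans e6
  refine wp_seq (wp_writeRows c₉ (fun v _ hv => mem_newBlack_iff I hv) e6 h₉) fun s₁₀ h₁₀ f₁₀ => ?_
  have c₁₀ := c₉.frame f₁₀ (by decide)
  have hpre : (kernel I).encode = _ := encode_kernel I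
  rw [encList, ← keptTo_eq] at hpre
  have := length_encode_kernel_le I
  refine wp_moveDown c₁₀ ?_ (by omega)
  rw [hpre]
  exact h₁₀.2

theorem polyTimeOn_kernel (D : Set GMAPFInstance) : GMAPF.PolyTimeOn D kernel := by
  obtain ⟨q, hq⟩ := exists_cost_polynomial kernelProg
  -- The input has length `row I.order I.order`, so the loop bound is `4 * X + 17` evaluated at the
  -- input length.
  refine ⟨kernelProg, q.comp (4 * Polynomial.X + 17), fun (I : GMAPFInstance) _ => ?_⟩
  obtain ⟨s', t, ht, hr, h⟩ := exists_runs_of_wp (wp_kernelProg I)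
  refine ⟨s', t, ht.trans_eq ?_, hr, h⟩
  change _ = (q.comp _).eval I.encode.length
  rw [hq, length_encode]
  simp

theorem computable_sizeBound : Computable fun n : ℕ =>
    3698 * (n * n * n) + 1 + 3698 * (n * n * n) * (3698 * (n * n * n) + 3) := by
  have hm : Primrec fun n : ℕ => 3698 * (n * n * n) :=
    Primrec.nat_mul.comp (Primrec.const _)
      (Primrec.nat_mul.comp (Primrec.nat_mul.comp Primrec.id Primrec.id) Primrec.id)
  exact (Primrec.nat_add.comp (Primrec.nat_add.comp hm (Primrec.const 1))
    (Primrec.nat_mul.comp hm (Primrec.nat_add.comp hm (Primrec.const 3)))).to_comp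

end Galactic

/-! ### The kernelization theorem -/

theorem mainTheorem4 :
    ∃ K : GMAPFInstance → GMAPFInstance,
      GMAPF.IsKernelizationOn {I | I.IsInducedGrid} K ∧
      ∃ C : ℕ, ∀ I : GMAPFInstance, I.IsInducedGrid →
        (K I).order ≤ C * I.agents ^ 3 := by
  refine ⟨Galactic.kernel, ⟨Galactic.polyTimeOn_kernel _,
    fun I _ => Galactic.solvable_kernel_iff, ⟨_, Galactic.computable_sizeBound, fun I hI => ?_⟩,
    fun I _ => Galactic.agents_kernel.le⟩, 3698, fun I hI => Galactic.order_kernel_le hI⟩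
  have h := Galactic.order_kernel_le hI
  rw [pow_succ, pow_two] at h
  change (Galactic.kernel I).encode.length ≤ _
  rw [Galactic.length_encode, Galactic.row]
  change _ ≤ 3698 * (I.agents * I.agents * I.agents) + 1 + _
  gcongr <;> exact h
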